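/- **Setting.** Let $h$ be a formal parameter and let $a,\bar a$ be elements of an associative unital $\mathbb C$-algebra $W$ with $[\bar a,a]=1$. Work in $W[[h]]$ ($h$ central) and put $$J_+=-\tfrac12a^2,\quad J_-=\tfrac12\bar a^2,\quad J_0=\tfrac12(a\bar a+\bar aa),\quad \sigma=-\ln(1-2hJ_+),\quad a_h=a\,e^{\sigma/2},\quad \bar a_h=\bar a\,e^{-\sigma/2}.$$ The adjoint action of the Jordanian quantum algebra ${\cal U}_h(sl(2))$ on $t\in W[[h]]$ is $$\mathrm{ad}J_0(t)=[J_0,t]e^{-\sigma},\qquad \mathrm{ad}J_+(t)=e^{-\sigma}[J_+e^{\sigma},t],$$ $$\mathrm{ad}J_-(t)=[J_-+hJ_0+\tfrac h2J_0^2,\,t]e^{-\sigma}-h[J_0,t]e^{-2\sigma}-\tfrac h2[J_0,[J_0,t]]e^{-2\sigma}.$$ Let $\tilde P_j^m$ ($j=0,\frac12,1,\dots$; $m=-j,-j+1,\dots,j$) be the $h$-symplecton, i.e. elements of $W[[h]]$ with $$\mathrm{ad}J_\pm(\tilde P_j^m)=\sqrt{(j\mp m)(j\pm m+1)}\,\tilde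 P_j^{m\pm1},\qquad \mathrm{ad}J_0(\tilde P_j^m)=2m\,\tilde P_j^m .$$ These relations leave one factor free for each $j$; it is fixed by $\tilde P_j^j=\frac{N_j}{\sqrt{(2j)!}}\,a_h^{2j}$ with arbitrary nonzero constants $N_j\in\mathbb C$. (The normalization $\tilde P_j^j=a_h^{2j}$ is $N_j=\sqrt{(2j)!}$.) Let $V^j$ be the spin-$j$ representation with basis $|jm\rangle$, $J_0|jm\rangle=2m|jm\rangle$, $J_+|jm\rangle=\sqrt{(j-m)(j+m+1)}\,|j\,m{+}1\rangle$; let ${\cal F}=\exp(-\frac12J_0\otimes\sigma)$, with $\sigma=-\ln(1-2hJ_+)$, act on $V^{j}\otimes V^{j'}$, and let $$F^{\;j,j'}_{k,k'\;m,m'}=\langle jk|\otimes\langle j'k'|\,{\cal F}\,|jm\rangle\otimes|j'm'\rangle,\qquad (F^{-1})^{\;j,j'}_{k,k'\;m,m'}=\langle jk|\otimes\langle j'k'|\,{\cal F}^{-1}\,|jm\rangle\otimes|j'm'\rangle$$ in $\mathbb C[[h]]$. Let $C^{j_1,j_2,j}_{m_1,m_2,m}$ be the (Condon–Shortley) Clebsch–Gordan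 coefficients of $sl(2)$, zero when $|m|>j$, and $$\langle k|j|j'\rangle=2^{k-j-j'}(2k+1)^{-1/2}\left[\frac{(k+j+j'+1)!}{(k+j-j')!\,(k-j+j')!\,(-k+j+j')!}\right]^{1/2}.$$ **Proposition 3.** For all spins $j,j'\in\{0,\frac12,1,\dots\}$: 1. For all $\ell\in\{-j,\dots,j\}$ and $\ell'\in\{-j',\dots,j'\}$, $$\sum_{m=-j}^{j}\sum_{m'=-j'}^{j'}\tilde P_j^m\,\tilde P_{j'}^{m'}\,F^{\;j,j'}_{m,m'\;\ell,\ell'}=\sum_{k=|j-j'|}^{j+j'}\frac{N_jN_{j'}}{N_k}\,\langle k|j|j'\rangle\,C^{\,j',\,j,\,k}_{\ell',\,\ell,\,\ell'+\ell}\;\tilde P_k^{\ell+\ell'}$$ (terms with $|\ell+\ell'|>k$ are zero). 2. For all $m\in\{-j,\dots,j\}$ and $m'\in\{-j',\dots,j'\}$, $\tilde P_{j'}^{m'}$ can be written as a noncommutative polynomial $\tilde P_{j'}^{m'}(a_h,\bar a_h)$ in $a_h,\bar a_h$ (and the central $h$), and for every such polynomial expression $$\tilde P_{j'}^{m'}(a_h,\bar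 a_h+2hm\,a_h)=\sum_{\ell=0}^{j'-m'}(F^{-1})^{\;j,j'}_{m,\,m'+\ell\;\;m,\,m'}\;\tilde P_{j'}^{m'+\ell}(a_h,\bar a_h).$$ -/

import Mathlib

open scoped Nat Kronecker

noncomputable section

namespace HSymplecton

/-!
Conventions. Spins and weights are half-integers and are stored doubled: a spin `j` is the natural
number `J = 2j`, a weight `m` is the integer `M = 2m`. The deformation parameter `h` is the formal
variable `PowerSeries.X`; the `h`-adic completion of an algebra `A` is `PowerSeries A`, in which `h`
is central.
-/

/-- The (doubled) weights `2m` of the spin-`J/2` representation, in decreasing order: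
the index `i` stands for `m = j - i`, so `i` runs over `0, …, 2j`. -/
def wt (J : ℕ) (i : Fin (J + 1)) : ℤ := (J : ℤ) - 2 * ((i : ℕ) : ℤ)

/-- `√((j - m)(j + m + 1))` for `j = J/2`, `m = M/2`. Raising from `m` uses `ladder J M`; lowering
from `m` uses `ladder J (-M)`. -/
def ladder (J : ℕ) (M : ℤ) : ℝ :=
  Real.sqrt ((((J : ℝ) - (M : ℝ)) / 2) * (((J : ℝ) + (M : ℝ)) / 2 + 1))

section Series

variable {A : Type*} [Ring A] [Algebra ℂ A]

/-- The exponential `∑ₖ fᵏ / k!` of a formal power series in `h` without constant term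
(`fᵏ` has order at least `k`, so the sum is finite in each degree). -/
def hexp (f : PowerSeries A) : PowerSeries A :=
  PowerSeries.mk fun n =>
    ∑ k ∈ Finset.range (n + 1), (1 / (k ! : ℂ)) • PowerSeries.coeff n (f ^ k)

/-- `σ = - ln (1 - 2 h J₊) = ∑_{n ≥ 1} (2 h J₊)ⁿ / n`. -/
def sigma (Jp : A) : PowerSeries A :=
  PowerSeries.mk fun n => if n = 0 then 0 else ((2 : ℂ) ^ n / (n : ℂ)) • Jp ^ n

/-- `e^{t σ}`. -/
def expSigma (Jp : A) (t : ℂ) : PowerSeries A := hexp (t • sigma Jp)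

/-- The commutator. -/
def comm (x y : PowerSeries A) : PowerSeries A := x * y - y * x

/-- Adjoint action of `J₀`:  `ad J₀ (t) = [J₀, t] e^{-σ}`. -/
def adJ0 (Jp J0 : A) (t : PowerSeries A) : PowerSeries A :=
  comm (PowerSeries.C J0) t * expSigma Jp (-1)

/-- Adjoint action of `J₊`:  `ad J₊ (t) = e^{-σ} [J₊ e^{σ}, t]`. -/
def adJp (Jp : A) (t : PowerSeries A) : PowerSeries A :=
  expSigma Jp (-1) * comm (PowerSeries.C Jp * expSigma Jp 1) t

/-- Adjoint action of `J₋`: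
`ad J₋ (t) = [J₋ + h J₀ + (h/2) J₀², t] e^{-σ} - h [J₀, t] e^{-2σ} - (h/2) [J₀, [J₀, t]] e^{-2σ}`. -/
def adJm (Jp J0 Jm : A) (t : PowerSeries A) : PowerSeries A :=
  comm (PowerSeries.C Jm + PowerSeries.X * PowerSeries.C J0
      + (1 / 2 : ℂ) • (PowerSeries.X * PowerSeries.C (J0 ^ 2))) t * expSigma Jp (-1)
    - PowerSeries.X * comm (PowerSeries.C J0) t * expSigma Jp (-2)
    - (1 / 2 : ℂ) • (PowerSeries.X * comm (PowerSeries.C J0) (comm (PowerSeries.C J0) t)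
        * expSigma Jp (-2))

/-- A scalar power series, regarded as an element of `A⟦h⟧`. -/
def scal (A : Type*) [Ring A] [Algebra ℂ A] (f : PowerSeries ℂ) : PowerSeries A :=
  PowerSeries.map (algebraMap ℂ A) f

end Series

section Boson

variable {W : Type*} [Ring W] [Algebra ℂ W]

/-- `J₊ = -a²/2`. -/
def bosJp (a : W) : W := -((1 / 2 : ℂ) • a ^ 2)

/-- `J₋ = ā²/2`. -/
def bosJm (abar : W) : W := (1 / 2 : ℂ) • abar ^ 2

/-- `J₀ = (a ā + ā a)/2`. -/
def bosJ0 (a abar : W) : W := (1 / 2 : ℂ) • (a * abar + abar * a)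

/-- `a_h = a e^{σ/2}`. -/
def ah (a : W) : PowerSeries W := PowerSeries.C a * expSigma (bosJp a) (1 / 2)

/-- `ā_h = ā e^{-σ/2}`. -/
def abarh (a abar : W) : PowerSeries W := PowerSeries.C abar * expSigma (bosJp a) (-(1 / 2))

/-- The family `P J M = P̃_j^m` is an `h`-symplecton (irreducible tensor operators of `U_h(sl(2))`
for the boson realization, one for each spin `j = 0, 1/2, 1, …`) with normalization
`P̃_j^j = (N_j / √(2j)!) a_h^{2j}`. The values `P J M` at integers `M` which are not doubled weights
of spin `J/2` are irrelevant: at the two ends of the ladder they occur with the coefficient `0`. -/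
structure IsHSymplecton (a abar : W) (N : ℕ → ℂ) (P : ℕ → ℤ → PowerSeries W) : Prop where
  raise : ∀ (J : ℕ) (m : Fin (J + 1)),
    adJp (bosJp a) (P J (wt J m)) = (ladder J (wt J m) : ℂ) • P J (wt J m + 2)
  lower : ∀ (J : ℕ) (m : Fin (J + 1)),
    adJm (bosJp a) (bosJ0 a abar) (bosJm abar) (P J (wt J m))
      = (ladder J (-wt J m) : ℂ) • P J (wt J m - 2)
  weight : ∀ (J : ℕ) (m : Fin (J + 1)),
    adJ0 (bosJp a) (bosJ0 a abar) (P J (wt J m)) = (wt J m : ℂ) • P J (wt J m)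
  top : ∀ J : ℕ, P J (J : ℤ) = (N J / (Real.sqrt (J ! : ℝ) : ℂ)) • ah a ^ J

/-- The value `p(x, y)` of a noncommutative polynomial `p` in two elements `x`, `y` and in `h`. -/
def evalPoly (x y : PowerSeries W) (p : FreeAlgebra ℂ (Fin 3)) : PowerSeries W :=
  FreeAlgebra.lift ℂ ![PowerSeries.X, x, y] p

end Boson

section Twist

/-- The matrix of `J₊` on `V^j`: `J₊ |j m⟩ = √((j - m)(j + m + 1)) |j m+1⟩`. -/
def matJp (J : ℕ) : Matrix (Fin (J + 1)) (Fin (J + 1)) ℂ :=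
  Matrix.of fun k m => if wt J k = wt J m + 2 then (ladder J (wt J m) : ℂ) else 0

/-- The matrix of `J₀` on `V^j`: `J₀ |j m⟩ = 2m |j m⟩`. -/
def matJ0 (J : ℕ) : Matrix (Fin (J + 1)) (Fin (J + 1)) ℂ :=
  Matrix.diagonal fun m => (wt J m : ℂ)

/-- The twist element `𝓕 = exp (-(1/2) J₀ ⊗ σ)` acting on `V^{j₁} ⊗ V^{j₂}`, as a power series in `h`
whose coefficients are matrices. -/
def twistSeries (J₁ J₂ : ℕ) :
    PowerSeries (Matrix (Fin (J₁ + 1) × Fin (J₂ + 1)) (Fin (J₁ + 1) × Fin (J₂ + 1)) ℂ) :=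
  hexp (-((1 / 2 : ℂ) • (PowerSeries.C (matJ0 J₁ ⊗ₖ (1 : Matrix (Fin (J₂ + 1)) (Fin (J₂ + 1)) ℂ))
    * sigma ((1 : Matrix (Fin (J₁ + 1)) (Fin (J₁ + 1)) ℂ) ⊗ₖ matJp J₂))))

/-- The matrix elements of `𝓕`: the entry at `(k₁, k₂)`, `(m₁, m₂)` is
`⟨j₁ k₁| ⊗ ⟨j₂ k₂| 𝓕 |j₁ m₁⟩ ⊗ |j₂ m₂⟩`, a power series in `h`. -/
def twistMatrix (J₁ J₂ : ℕ) :
    Matrix (Fin (J₁ + 1) × Fin (J₂ + 1)) (Fin (J₁ + 1) × Fin (J₂ + 1)) (PowerSeries ℂ) :=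
  Matrix.of fun k m => PowerSeries.mk fun n => PowerSeries.coeff n (twistSeries J₁ J₂) k m

end Twist

section Coupling

/-- `1 / n!`, with the convention that it vanishes for `n < 0`. -/
def invFact (n : ℤ) : ℝ := if n < 0 then 0 else 1 / (n.toNat ! : ℝ)

/-- `(n/2)!` for an even nonnegative integer `n`. -/
def halfFact (n : ℤ) : ℝ := ((n / 2).toNat ! : ℝ)

/-- `M` is a doubled weight of the spin `J/2`: `|m| ≤ j` and `j - m` is an integer. -/
def IsWeight (J : ℕ) (M : ℤ) : Prop := |M| ≤ (J : ℤ) ∧ (2 : ℤ) ∣ (J : ℤ) - M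

/-- The (doubled) spins `k = |j - j'|, |j - j'| + 1, …, j + j'`. -/
def coupledSpins (J J' : ℕ) : Finset ℕ :=
  (Finset.Icc (Nat.dist J J') (J + J')).filter fun K => K % 2 = (J + J') % 2

open Classical in
/-- The Clebsch–Gordan coefficient `C^{j₁, j₂, j}_{m₁, m₂, m}` of `sl(2)` in the Condon–Shortley
convention (Racah's formula); it is `0` unless `j` occurs in `j₁ ⊗ j₂`, the `m`'s are weights of the
corresponding spins and `m = m₁ + m₂`. -/
def clebschGordan (J₁ J₂ J : ℕ) (M₁ M₂ M : ℤ) : ℝ :=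
  if J ∈ coupledSpins J₁ J₂ ∧ IsWeight J₁ M₁ ∧ IsWeight J₂ M₂ ∧ IsWeight J M ∧ M = M₁ + M₂ then
    Real.sqrt (((J : ℝ) + 1) * halfFact (J + J₁ - J₂) * halfFact (J - J₁ + J₂)
        * halfFact (J₁ + J₂ - J) / halfFact (J₁ + J₂ + J + 2))
      * Real.sqrt (halfFact (J + M) * halfFact (J - M) * halfFact (J₁ - M₁) * halfFact (J₁ + M₁)
        * halfFact (J₂ - M₂) * halfFact (J₂ + M₂))
      * ∑ k ∈ Finset.range ((J₁ + J₂ - J) / 2 + 1),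
          (-1 : ℝ) ^ k * invFact k * invFact (((J₁ : ℤ) + J₂ - J) / 2 - k)
            * invFact (((J₁ : ℤ) - M₁) / 2 - k) * invFact (((J₂ : ℤ) + M₂) / 2 - k)
            * invFact (((J : ℤ) - J₂ + M₁) / 2 + k) * invFact (((J : ℤ) - J₁ - M₂) / 2 + k)
  else 0

/-- The triangle function
`∇(abc) = √((a+b+c+1)! / ((a+b-c)! (a-b+c)! (-a+b+c)!))`, in doubled spins. -/
def nabla (A B C : ℕ) : ℝ :=
  Real.sqrt (halfFact (A + B + C + 2)
    / (halfFact (A + B - C) * halfFact (A - B + C) * halfFact (-A + B + C)))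

/-- `⟨k|j|j'⟩ = 2^{k-j-j'} (2k+1)^{-1/2} ∇(k j j')`, in doubled spins. -/
def redElt (K J J' : ℕ) : ℝ :=
  (2 : ℝ) ^ (((K : ℤ) - J - J') / 2) * (Real.sqrt ((K : ℝ) + 1))⁻¹ * nabla K J J'

end Coupling

end HSymplecton

end

/-!
The deformation is undone by a Drinfeld twist. For `Q ∈ W` of weight `m`, the deformed lowering
operator applied to `Q e^{mσ}` is `[J₋, Q] e^{(m-1)σ}` (`adJm_mul_expSigma`), so that lowering from
`a_h^{2j} = a^{2j} e^{jσ}` gives `P̃_j^m = (N_j / √((j+m)! (j-m)!)) S(j+m, j-m) e^{mσ}`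
(`IsHSymplecton.eq_weylMono`), where `S(u, v)` is the Weyl-symmetrized monomial `a^u ā^v`, on which
`[ā²/2, ·]` acts as on commutative monomials.

Both parts rest on one fact: conjugation by `e^{sσ}` acts on the components `P̃_j^m` through the
matrix of `e^{sσ}` on `V^j` (`IsHSymplecton.conj_expSigma`). For `e^{-σ} = 1 - 2hJ₊` this is the
raising relation, the natural powers follow, and in each degree in `h` both sides are polynomial in
`s`. As `J₀` is diagonal, the twist is block diagonal with blocks `e^{-mσ}` (`twistMatrix_apply`).

* Part 2: conjugation by `e^{mσ}` fixes `a_h` and takes `ā_h` to `ā_h + 2hm a_h`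
  (`expSigma_mul_abarh`). Hence the shifted polynomial is `e^{mσ} P̃_{j'}^{m'} e^{-mσ}`, which the
  matrix of `e^{mσ}` expands. That `P̃_{j'}^{m'}` is a polynomial in `a_h`, `ā_h` is seen by
  recursion on the exponent of `ā`, since these polynomials are stable under such conjugations
  (`weylMono_mem_polySubalgebra`).
* Part 1: the twist cancels the exponentials between the two factors, and the left side becomes the
  product of the undeformed components times `e^{(m+m')σ}`. Symmetrized monomials multiply by the
  Moyal formula (`weylMono_mul_weylMono`), proved by induction through left multiplication by `a`
  and `ā`. Its terms of order `r` belong to the spin `k = j + j' - r`, and their coefficients are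
  Racah's sum for the Clebsch–Gordan coefficient; `⟨k|j|j'⟩` reduces the square roots in Racah's
  formula to `2^{-r}` (`redElt_mul_clebschGordan`).
-/

noncomputable section

namespace HSymplecton

/-! ### The scalar series `(1 - 2h)^{-t}` -/

section Scalar

lemma coeff_pow_eq_zero_of_lt {R : Type*} [Ring R] {f : PowerSeries R}
    (hf : PowerSeries.constantCoeff f = 0) {n k : ℕ} (h : n < k) :
    PowerSeries.coeff n (f ^ k) = 0 := by
  have h1 : PowerSeries.X ∣ f := PowerSeries.X_dvd_iff.2 hf
  obtain ⟨g, rfl⟩ := h1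
  have : (PowerSeries.X * g) ^ k = PowerSeries.X ^ k * g ^ k :=
    (PowerSeries.commute_X g).symm.mul_pow k
  rw [this]
  exact PowerSeries.X_pow_dvd_iff.1 (Dvd.intro _ rfl) n h

/-- The sum defining a coefficient of `hexp f` may be extended beyond the degree. -/
lemma coeff_hexp_of_lt {R : Type*} [Ring R] [Algebra ℂ R] {f : PowerSeries R}
    (hf : PowerSeries.constantCoeff f = 0) {n M : ℕ} (h : n < M) :
    PowerSeries.coeff n (hexp f)
      = ∑ k ∈ Finset.range M, (1 / (k ! : ℂ)) • PowerSeries.coeff n (f ^ k) := by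
  rw [hexp, PowerSeries.coeff_mk]
  refine Finset.sum_subset (by simpa using h) fun k _ hk => ?_
  rw [coeff_pow_eq_zero_of_lt hf (by simpa using hk), smul_zero]

open PowerSeries in
lemma derivative_hexp {f : PowerSeries ℂ} (hf : constantCoeff f = 0) :
    derivative ℂ (hexp f) = hexp f * derivative ℂ f := by
  ext n
  rw [coeff_derivative, coeff_hexp_of_lt hf (Nat.lt_succ_self (n + 1)), coeff_mul]
  have h1 : ∀ p ∈ Finset.HasAntidiagonal.antidiagonal n,
      coeff p.1 (hexp f) * coeff p.2 (derivative ℂ f) = ∑ k ∈ Finset.range (n + 1),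
          (1 / (k ! : ℂ)) * (coeff p.1 (f ^ k) * coeff p.2 (derivative ℂ f)) := by
    intro p hp
    have : p.1 ≤ n := by
      have := Finset.HasAntidiagonal.mem_antidiagonal.1 hp
      omega
    rw [coeff_hexp_of_lt hf (Nat.lt_succ_of_le this), Finset.sum_mul]
    exact Finset.sum_congr rfl fun k _ => by rw [smul_eq_mul, mul_assoc]
  rw [Finset.sum_congr rfl h1, Finset.sum_comm, Finset.sum_range_succ', add_mul, Finset.sum_mul]
  have h0 : coeff (n + 1) (f ^ 0) = 0 := by simp [coeff_one]
  rw [h0, smul_zero, zero_mul, add_zero]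
  refine Finset.sum_congr rfl fun k _ => ?_
  rw [← Finset.mul_sum, ← coeff_mul, smul_eq_mul, mul_assoc]
  have h2 := congrArg (coeff n) (derivative_pow (R := ℂ) f (k + 1))
  rw [coeff_derivative] at h2
  rw [h2, Nat.add_sub_cancel, mul_assoc, show ((k + 1 : ℕ) : PowerSeries ℂ)
    = C ((k + 1 : ℕ) : ℂ) by simp, coeff_C_mul, Nat.factorial_succ]
  have : (k ! : ℂ) ≠ 0 := by exact_mod_cast Nat.factorial_ne_zero k
  have : ((k : ℂ) + 1) ≠ 0 := by exact_mod_cast Nat.succ_ne_zero k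
  push_cast
  field_simp

open PowerSeries in
lemma constantCoeff_sigma {A : Type*} [Ring A] [Algebra ℂ A] (x : A) :
    constantCoeff (sigma x) = 0 := by
  rw [← coeff_zero_eq_constantCoeff_apply, sigma, coeff_mk, if_pos rfl]

open PowerSeries in
lemma constantCoeff_hexp {A : Type*} [Ring A] [Algebra ℂ A] (f : PowerSeries A) :
    constantCoeff (hexp f) = 1 := by
  rw [← coeff_zero_eq_constantCoeff_apply, hexp, coeff_mk]
  simp

open PowerSeries in
lemma one_sub_mul_derivative_sigma :
    (1 - (2 : ℂ) • (X : PowerSeries ℂ)) * derivative ℂ (sigma (1 : ℂ)) = C 2 := by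
  have hc : ∀ n, coeff n (derivative ℂ (sigma (1 : ℂ))) = 2 * 2 ^ n := by
    intro n
    rw [coeff_derivative, sigma, coeff_mk, if_neg n.succ_ne_zero]
    have : ((n : ℂ) + 1) ≠ 0 := by exact_mod_cast Nat.succ_ne_zero n
    simp only [one_pow, smul_eq_mul, mul_one]
    push_cast
    field_simp
    ring
  ext n
  rw [sub_mul, one_mul, smul_mul_assoc, map_sub, hc, coeff_smul]
  cases n with
  | zero => simp
  | succ n =>
    rw [coeff_succ_X_mul, hc, coeff_C, if_neg n.succ_ne_zero, smul_eq_mul]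
    ring

/-- The scalar series `e^{tσ} = (1 - 2h)^{-t}` satisfies `(1 - 2h) y' = 2 t y`. -/
lemma one_sub_mul_derivative_expSigma (t : ℂ) :
    (1 - (2 : ℂ) • (PowerSeries.X : PowerSeries ℂ))
        * PowerSeries.derivative ℂ (expSigma (1 : ℂ) t)
      = (2 * t) • expSigma (1 : ℂ) t := by
  have h0 : PowerSeries.constantCoeff (t • sigma (1 : ℂ)) = 0 := by
    rw [PowerSeries.constantCoeff_smul, constantCoeff_sigma, smul_zero]
  rw [expSigma, derivative_hexp h0, Derivation.map_smul]
  rw [mul_left_comm, mul_smul_comm, one_sub_mul_derivative_sigma]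
  simp only [PowerSeries.smul_eq_C_mul, map_mul]
  ring

open PowerSeries in
lemma coeff_succ_of_ode {t : ℂ} {y : PowerSeries ℂ}
    (hy : (1 - (2 : ℂ) • (X : PowerSeries ℂ)) * derivative ℂ y = (2 * t) • y) (n : ℕ) :
    ((n : ℂ) + 1) * coeff (n + 1) y = 2 * (t + n) * coeff n y := by
  have h := congrArg (coeff n) hy
  rw [sub_mul, one_mul, smul_mul_assoc, map_sub, coeff_smul, coeff_smul, coeff_derivative,
    smul_eq_mul, smul_eq_mul] at h
  cases n with
  | zero =>
    rw [coeff_zero_X_mul] at h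
    push_cast at h ⊢
    linear_combination h
  | succ n =>
    rw [coeff_succ_X_mul, coeff_derivative] at h
    push_cast at h ⊢
    linear_combination h

open PowerSeries in
/-- The differential equation `(1 - 2h) y' = 2 t y` determines the coefficients of `y`, which are
polynomials in `t`. -/
lemma coeff_of_ode {t : ℂ} {y : PowerSeries ℂ} (h0 : constantCoeff y = 1)
    (hy : (1 - (2 : ℂ) • (X : PowerSeries ℂ)) * derivative ℂ y = (2 * t) • y) (n : ℕ) :
    coeff n y = 2 ^ n / (n ! : ℂ) * (ascPochhammer ℂ n).eval t := by
  induction n with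
  | zero => simpa using h0
  | succ n ih =>
    have h := coeff_succ_of_ode hy n
    rw [ih] at h
    have h1 : ((n : ℂ) + 1) ≠ 0 := by exact_mod_cast Nat.succ_ne_zero n
    have h2 : (n ! : ℂ) ≠ 0 := by exact_mod_cast Nat.factorial_ne_zero n
    rw [ascPochhammer_succ_eval, Nat.factorial_succ]
    apply mul_left_cancel₀ h1
    rw [h]
    push_cast
    field_simp
    ring

lemma constantCoeff_expSigma {A : Type*} [Ring A] [Algebra ℂ A] (x : A) (t : ℂ) :
    PowerSeries.constantCoeff (expSigma x t) = 1 :=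
  constantCoeff_hexp _

lemma coeff_expSigma_one (t : ℂ) (n : ℕ) :
    PowerSeries.coeff n (expSigma (1 : ℂ) t) = 2 ^ n / (n ! : ℂ) * (ascPochhammer ℂ n).eval t :=
  coeff_of_ode (constantCoeff_expSigma _ _) (one_sub_mul_derivative_expSigma t) n

lemma eq_expSigma_one_of_ode {t : ℂ} {y : PowerSeries ℂ} (h0 : PowerSeries.constantCoeff y = 1)
    (hy : (1 - (2 : ℂ) • (PowerSeries.X : PowerSeries ℂ)) * PowerSeries.derivative ℂ y
      = (2 * t) • y) :
    y = expSigma (1 : ℂ) t := by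
  ext n
  rw [coeff_of_ode h0 hy, coeff_expSigma_one]

lemma expSigma_one_mul (s t : ℂ) :
    expSigma (1 : ℂ) s * expSigma (1 : ℂ) t = expSigma (1 : ℂ) (s + t) := by
  apply eq_expSigma_one_of_ode
  · rw [map_mul, constantCoeff_expSigma, constantCoeff_expSigma, one_mul]
  · have hs := one_sub_mul_derivative_expSigma s
    have ht := one_sub_mul_derivative_expSigma t
    rw [Derivation.leibniz]
    simp only [PowerSeries.smul_eq_C_mul, smul_eq_mul, map_mul, map_add] at hs ht ⊢
    linear_combination expSigma (1 : ℂ) s * ht + expSigma (1 : ℂ) t * hs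

lemma expSigma_one_zero : expSigma (1 : ℂ) 0 = 1 :=
  (eq_expSigma_one_of_ode (by simp) (by simp)).symm

lemma expSigma_one_neg_one :
    expSigma (1 : ℂ) (-1) = 1 - (2 : ℂ) • (PowerSeries.X : PowerSeries ℂ) := by
  refine (eq_expSigma_one_of_ode (by simp) ?_).symm
  rw [map_sub, Derivation.map_smul, PowerSeries.derivative_X, PowerSeries.derivative_one]
  rw [PowerSeries.smul_eq_C_mul, PowerSeries.smul_eq_C_mul, PowerSeries.smul_eq_C_mul]
  simp only [map_mul, map_neg, map_one]
  ring

lemma derivative_expSigma_one (t : ℂ) :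
    PowerSeries.derivative ℂ (expSigma (1 : ℂ) t) = (2 * t) • expSigma (1 : ℂ) (t + 1) := by
  have h : expSigma (1 : ℂ) 1 * _ = expSigma (1 : ℂ) 1 * _ :=
    congrArg (expSigma (1 : ℂ) 1 * ·) (one_sub_mul_derivative_expSigma t)
  rw [← mul_assoc, ← expSigma_one_neg_one, expSigma_one_mul, add_neg_cancel, expSigma_one_zero,
    one_mul, mul_smul_comm, expSigma_one_mul, add_comm 1 t] at h
  exact h

end Scalar

/-! ### Transport along `h ↦ h x` -/

section Transport

variable {A : Type*} [Ring A] [Algebra ℂ A]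

open PowerSeries in
/-- The substitution `f(h) ↦ f(h x)`, as a homomorphism `ℂ⟦h⟧ → A⟦h⟧`. Its image is
commutative, which moves computations with `σ` and `e^{tσ}` to scalar series. -/
def scaleHom (x : A) : PowerSeries ℂ →ₐ[ℂ] PowerSeries A where
  toFun f := PowerSeries.mk fun n => coeff n f • x ^ n
  map_one' := by
    ext n
    rw [coeff_mk, coeff_one, coeff_one]
    split_ifs with h
    · simp [h]
    · simp
  map_mul' f g := by
    ext n
    rw [coeff_mk, coeff_mul, coeff_mul, Finset.sum_smul]
    refine Finset.sum_congr rfl fun p hp => ?_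
    rw [coeff_mk, coeff_mk, smul_mul_smul_comm, ← pow_add,
      Finset.HasAntidiagonal.mem_antidiagonal.1 hp]
  map_zero' := by ext; simp
  map_add' f g := by ext; simp [add_smul]
  commutes' r := by
    ext n
    rw [PowerSeries.algebraMap_apply, PowerSeries.algebraMap_apply, coeff_mk, coeff_C, coeff_C]
    split_ifs with h
    · simp [h, Algebra.smul_def]
    · simp

@[simp]
lemma coeff_scaleHom (x : A) (f : PowerSeries ℂ) (n : ℕ) :
    PowerSeries.coeff n (scaleHom x f) = PowerSeries.coeff n f • x ^ n := by
  change PowerSeries.coeff n (PowerSeries.mk fun n => PowerSeries.coeff n f • x ^ n) = _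
  rw [PowerSeries.coeff_mk]

lemma scaleHom_X (x : A) : scaleHom x PowerSeries.X = PowerSeries.X * PowerSeries.C x := by
  ext n
  rw [coeff_scaleHom, PowerSeries.coeff_mul_C, PowerSeries.coeff_X, PowerSeries.coeff_X]
  split_ifs with h
  · simp [h]
  · simp

lemma scaleHom_sigma (x : A) : scaleHom x (sigma (1 : ℂ)) = sigma x := by
  ext n
  rw [coeff_scaleHom, sigma, sigma, PowerSeries.coeff_mk, PowerSeries.coeff_mk]
  split_ifs <;> simp

lemma scaleHom_hexp (x : A) (f : PowerSeries ℂ) : scaleHom x (hexp f) = hexp (scaleHom x f) := by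
  ext n
  rw [coeff_scaleHom, hexp, hexp, PowerSeries.coeff_mk, PowerSeries.coeff_mk, Finset.sum_smul]
  refine Finset.sum_congr rfl fun k _ => ?_
  rw [← map_pow, coeff_scaleHom, smul_assoc]

lemma scaleHom_expSigma (x : A) (t : ℂ) : scaleHom x (expSigma (1 : ℂ) t) = expSigma x t := by
  rw [expSigma, scaleHom_hexp, map_smul, scaleHom_sigma, expSigma]

lemma coeff_expSigma (x : A) (t : ℂ) (n : ℕ) :
    PowerSeries.coeff n (expSigma x t)
      = (2 ^ n / (n ! : ℂ) * (ascPochhammer ℂ n).eval t) • x ^ n := by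
  rw [← scaleHom_expSigma, coeff_scaleHom, coeff_expSigma_one]

lemma expSigma_mul (x : A) (s t : ℂ) :
    expSigma x s * expSigma x t = expSigma x (s + t) := by
  rw [← scaleHom_expSigma x s, ← scaleHom_expSigma x t, ← map_mul, expSigma_one_mul,
    scaleHom_expSigma]

lemma expSigma_zero (x : A) : expSigma x 0 = 1 := by
  rw [← scaleHom_expSigma, expSigma_one_zero, map_one]

lemma expSigma_neg_one (x : A) :
    expSigma x (-1) = 1 - (2 : ℂ) • (PowerSeries.X * PowerSeries.C x) := by
  rw [← scaleHom_expSigma, expSigma_one_neg_one, map_sub, map_one, map_smul, scaleHom_X]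

lemma expSigma_mul_assoc (x : A) (s t : ℂ) (y : PowerSeries A) :
    expSigma x s * (expSigma x t * y) = expSigma x (s + t) * y := by
  rw [← mul_assoc, expSigma_mul]

lemma commute_C_expSigma {x y : A} (h : Commute y x) (t : ℂ) :
    Commute (PowerSeries.C y) (expSigma x t) := by
  ext n
  rw [PowerSeries.coeff_C_mul, PowerSeries.coeff_mul_C, coeff_expSigma, mul_smul_comm,
    smul_mul_assoc, (h.pow_right n).eq]

end Transport

/-! ### Symmetrized monomials in the Weyl algebra -/

section Weyl

variable {W : Type*} [Ring W] [Algebra ℂ W]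

/-- The Weyl-symmetrized monomial `a^u ā^v` (the average of all its orderings), defined by the
recursion `a^u ā^{v+1} = ā · a^u ā^v - (u/2) a^{u-1} ā^v`. For `u = 0` the last term vanishes, so
that the truncated subtraction is harmless. -/
def weylMono (a abar : W) : ℕ → ℕ → W
  | u, 0 => a ^ u
  | u, v + 1 => abar * weylMono a abar u v - ((u : ℂ) / 2) • weylMono a abar (u - 1) v

variable {a abar : W}

lemma abar_mul_weylMono (u v : ℕ) :
    abar * weylMono a abar u v
      = weylMono a abar u (v + 1) + ((u : ℂ) / 2) • weylMono a abar (u - 1) v := by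
  rw [weylMono, sub_add_cancel]

/-- `[ā, a^n] = n a^{n-1}`. -/
lemma abar_mul_pow (h : abar * a - a * abar = 1) (n : ℕ) :
    abar * a ^ n = a ^ n * abar + (n : ℂ) • a ^ (n - 1) := by
  induction n with
  | zero => simp
  | succ n ih =>
    have h' : abar * a = a * abar + 1 := by rw [← h]; abel
    have e : (n : ℂ) • (a * a ^ (n - 1)) = (n : ℂ) • a ^ n := by
      cases n with
      | zero => simp
      | succ n => rw [Nat.add_sub_cancel, pow_succ']
    rw [pow_succ', ← mul_assoc, h', add_mul, one_mul, mul_assoc, ih, mul_add, mul_smul_comm, e,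
      Nat.add_sub_cancel]
    push_cast
    rw [← mul_assoc]
    module

/-- The truncation in `u - 1` at `u = 0` is invisible behind the factor `u`. -/
lemma smul_sub_one_comm (u : ℕ) (f : ℕ → W) :
    (u : ℂ) • f (u - 1 + 1) = (u : ℂ) • f u := by
  cases u with
  | zero => simp
  | succ n => rfl

/-- `[ā, a^u ā^v] = u a^{u-1} ā^v`. -/
lemma weylMono_mul_abar (h : abar * a - a * abar = 1) (u v : ℕ) :
    weylMono a abar u v * abar
      = abar * weylMono a abar u v - (u : ℂ) • weylMono a abar (u - 1) v := by
  induction v generalizing u with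
  | zero => simp only [weylMono]; rw [abar_mul_pow h]; abel
  | succ v ih =>
    simp only [weylMono, sub_mul, smul_mul_assoc, mul_assoc, ih, mul_sub, mul_smul_comm]
    module

/-- `a · a^u ā^v = a^{u+1} ā^v - (v/2) a^u ā^{v-1}`, the products on the right being
symmetrized. -/
lemma a_mul_weylMono (h : abar * a - a * abar = 1) (u v : ℕ) :
    a * weylMono a abar u v
      = weylMono a abar (u + 1) v - ((v : ℂ) / 2) • weylMono a abar u (v - 1) := by
  induction v generalizing u with
  | zero => simp [weylMono, pow_succ']
  | succ v ih =>
    have h' : a * abar = abar * a - 1 := by rw [← h]; abel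
    have e1 : (v : ℂ) • (abar * weylMono a abar u (v - 1))
        = (v : ℂ) • (weylMono a abar u v
          + ((u : ℂ) / 2) • weylMono a abar (u - 1) (v - 1)) := by
      cases v with
      | zero => simp
      | succ n => rw [abar_mul_weylMono, Nat.add_sub_cancel]
    have e2 := smul_sub_one_comm u fun x => weylMono a abar x v
    rw [weylMono, mul_sub, mul_smul_comm, ← mul_assoc, h', sub_mul, one_mul, mul_assoc, ih, ih,
      weylMono, mul_sub, mul_smul_comm, Nat.add_sub_cancel]
    have e1' : ((v : ℂ) / 2) • (abar * weylMono a abar u (v - 1))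
        = ((v : ℂ) / 2) • (weylMono a abar u v
          + ((u : ℂ) / 2) • weylMono a abar (u - 1) (v - 1)) := by
      rw [div_eq_inv_mul, mul_smul, e1, mul_smul]
    have e2' : ((u : ℂ) / 2) • weylMono a abar (u - 1 + 1) v
        = ((u : ℂ) / 2) • weylMono a abar u v := by
      rw [div_eq_inv_mul, mul_smul, e2, mul_smul]
    rw [e1', smul_sub, e2', Nat.add_sub_cancel]
    push_cast
    module

/-- `[ā²/2, a^u ā^v] = u a^{u-1} ā^{v+1}`: lowering acts on symmetrized monomials as on commutative
ones. -/
lemma bosJm_comm_weylMono (h : abar * a - a * abar = 1) (u v : ℕ) :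
    bosJm abar * weylMono a abar u v - weylMono a abar u v * bosJm abar
      = (u : ℂ) • weylMono a abar (u - 1) (v + 1) := by
  have e1 : weylMono a abar u v * abar ^ 2 = abar ^ 2 * weylMono a abar u v
      - (2 * (u : ℂ)) • (abar * weylMono a abar (u - 1) v)
      + ((u : ℂ) * ((u - 1 : ℕ) : ℂ)) • weylMono a abar (u - 1 - 1) v := by
    rw [pow_two, ← mul_assoc, weylMono_mul_abar h, sub_mul, smul_mul_assoc, mul_assoc,
      weylMono_mul_abar h, weylMono_mul_abar h, mul_sub, mul_smul_comm, ← mul_assoc]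
    module
  rw [bosJm, smul_mul_assoc, mul_smul_comm, e1, abar_mul_weylMono]
  module

end Weyl

/-! ### The Moyal product of symmetrized monomials -/

lemma invFact_natCast (n : ℕ) : invFact n = 1 / (n ! : ℝ) := by
  rw [invFact, if_neg (by omega), Int.toNat_natCast]

lemma invFact_of_neg {n : ℤ} (h : n < 0) : invFact n = 0 := if_pos h

/-- The recursion `n / n! = 1 / (n-1)!` holds for every integer `n`. -/
lemma mul_invFact (n : ℤ) : (n : ℂ) * (invFact n : ℂ) = (invFact (n - 1) : ℂ) := by
  rcases lt_trichotomy n 0 with h | rfl | h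
  · rw [invFact_of_neg h, invFact_of_neg (by omega)]; simp
  · rw [invFact_of_neg (show (0 : ℤ) - 1 < 0 by decide)]; simp
  · obtain ⟨m, rfl⟩ : ∃ m : ℕ, n = (m : ℤ) + 1 := ⟨(n - 1).toNat, by omega⟩
    rw [add_sub_cancel_right, show ((m : ℤ) + 1) = ((m + 1 : ℕ) : ℤ) by push_cast; rfl,
      invFact_natCast, invFact_natCast, Nat.factorial_succ]
    have : ((m : ℂ) + 1) ≠ 0 := by exact_mod_cast Nat.succ_ne_zero m
    have : (m ! : ℂ) ≠ 0 := by exact_mod_cast Nat.factorial_ne_zero m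
    push_cast
    field_simp

section Moyal

variable {W : Type*} [Ring W] [Algebra ℂ W]

/-- The symmetrized monomial `a^u ā^v` for integer exponents, zero if one of them is negative. -/
def weylZ (a abar : W) (u v : ℤ) : W :=
  if u < 0 ∨ v < 0 then 0 else weylMono a abar u.toNat v.toNat

lemma weylZ_natCast (a abar : W) (u v : ℕ) : weylZ a abar u v = weylMono a abar u v := by
  rw [weylZ, if_neg (by omega), Int.toNat_natCast, Int.toNat_natCast]

lemma weylZ_of_left_neg (a abar : W) {u : ℤ} (v : ℤ) (h : u < 0) : weylZ a abar u v = 0 :=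
  if_pos (Or.inl h)

lemma weylZ_of_right_neg (a abar : W) (u : ℤ) {v : ℤ} (h : v < 0) : weylZ a abar u v = 0 :=
  if_pos (Or.inr h)

variable {a abar : W}

lemma abar_mul_weylZ (u : ℤ) {v : ℤ} (hv : 0 ≤ v) :
    abar * weylZ a abar u v
      = weylZ a abar u (v + 1) + ((u : ℂ) / 2) • weylZ a abar (u - 1) v := by
  rcases lt_or_ge u 0 with hu | hu
  · rw [weylZ_of_left_neg _ _ _ hu, weylZ_of_left_neg _ _ _ hu,
      weylZ_of_left_neg _ _ _ (by omega)]
    simp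
  lift u to ℕ using hu
  lift v to ℕ using hv
  rw [weylZ_natCast, abar_mul_weylMono, show ((v : ℤ) + 1) = ((v + 1 : ℕ) : ℤ) by push_cast; rfl,
    weylZ_natCast]
  cases u with
  | zero => simp
  | succ n =>
    rw [show (((n + 1 : ℕ) : ℤ) - 1) = (n : ℤ) by push_cast; ring, weylZ_natCast,
      Nat.add_sub_cancel, Int.cast_natCast]

lemma a_mul_weylZ (h : abar * a - a * abar = 1) {u : ℤ} (v : ℤ) (hu : 0 ≤ u) :
    a * weylZ a abar u v
      = weylZ a abar (u + 1) v - ((v : ℂ) / 2) • weylZ a abar u (v - 1) := by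
  rcases lt_or_ge v 0 with hv | hv
  · rw [weylZ_of_right_neg _ _ _ hv, weylZ_of_right_neg _ _ _ hv,
      weylZ_of_right_neg _ _ _ (by omega)]
    simp
  lift u to ℕ using hu
  lift v to ℕ using hv
  rw [weylZ_natCast, a_mul_weylMono h, show ((u : ℤ) + 1) = ((u + 1 : ℕ) : ℤ) by push_cast; rfl,
    weylZ_natCast]
  cases v with
  | zero => simp
  | succ n =>
    rw [show (((n + 1 : ℕ) : ℤ) - 1) = (n : ℤ) by push_cast; ring, weylZ_natCast,
      Nat.add_sub_cancel, Int.cast_natCast]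

/-- The coefficient of the term `(∂_ā^i ∂_a^k f) (∂_a^i ∂_ā^k g)` of the Moyal product of
`f = a^p ā^q / (p! q!)` and `g = a^c ā^d / (c! d!)`. -/
def moyalCoeff (p q c d : ℤ) (i k : ℕ) : ℂ :=
  (1 / 2) ^ i * (-1 / 2) ^ k * invFact i * invFact k * invFact (p - k) * invFact (q - i)
    * invFact (c - i) * invFact (d - k)

lemma moyalCoeff_eq_zero {p q c d : ℤ} {i k : ℕ} (h : p < k ∨ q < i ∨ c < i ∨ d < k) :
    moyalCoeff p q c d i k = 0 := by
  rcases h with h | h | h | h <;> simp [moyalCoeff, invFact_of_neg (sub_neg.2 h)]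

lemma moyalCoeff_ne_zero {p q c d : ℤ} {i k : ℕ} (h : moyalCoeff p q c d i k ≠ 0) :
    (k : ℤ) ≤ p ∧ (i : ℤ) ≤ q ∧ (i : ℤ) ≤ c ∧ (k : ℤ) ≤ d := by
  by_contra hc
  exact h (moyalCoeff_eq_zero (by omega))

/-- A term of the Moyal product, with a shift `(x, y)` of the exponents of the monomial. -/
def moyalTerm (a abar : W) (p q c d x y : ℤ) (i k : ℕ) : W :=
  moyalCoeff p q c d i k • weylZ a abar (p + c - i - k + x) (q + d - i - k + y)

/-- The Moyal product of `a^p ā^q / (p! q!)` and `a^c ā^d / (c! d!)`, summed over `i, k < M`. -/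
def moyalSum (a abar : W) (M : ℕ) (p q c d x y : ℤ) : W :=
  ∑ i ∈ Finset.range M, ∑ k ∈ Finset.range M, moyalTerm a abar p q c d x y i k

/-- Left multiplication by `ā` raises the exponent of `ā`, up to `[ā, ·] / 2`, the derivative with
respect to `a`, which falls on one of the two factors. -/
lemma abar_mul_moyalTerm (p q c d : ℤ) (i k : ℕ) :
    abar * moyalTerm a abar p q c d 0 0 i k
      = moyalTerm a abar p q c d 0 1 i k
        + ((1 / 2 : ℂ) • moyalTerm a abar (p - 1) q c d 0 0 i k
          + (1 / 2 : ℂ) • moyalTerm a abar p q (c - 1) d 0 0 i k) := by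
  have e : moyalCoeff (p - 1) q c d i k + moyalCoeff p q (c - 1) d i k
      = (((p + c - i - k + 0 : ℤ)) : ℂ) * moyalCoeff p q c d i k := by
    have h1 := mul_invFact (p - k)
    have h2 := mul_invFact (c - i)
    rw [show p - k - 1 = p - 1 - k by ring] at h1
    rw [show c - i - 1 = c - 1 - i by ring] at h2
    push_cast at h1 h2
    rw [moyalCoeff, moyalCoeff, moyalCoeff, ← h1, ← h2]
    push_cast
    ring
  simp only [moyalTerm]
  rw [show p - 1 + c - i - k + 0 = p + c - i - k + 0 - 1 by ring,
    show p + (c - 1) - i - k + 0 = p + c - i - k + 0 - 1 by ring, ← smul_add, ← add_smul, e]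
  by_cases h0 : moyalCoeff p q c d i k = 0
  · simp [h0]
  obtain ⟨_, h1, _, h2⟩ := moyalCoeff_ne_zero h0
  rw [mul_smul_comm, abar_mul_weylZ _ (by omega), add_zero (_ - _ : ℤ), add_zero (_ - _ : ℤ)]
  module

lemma a_mul_moyalTerm (h : abar * a - a * abar = 1) (p q c d : ℤ) (i k : ℕ) :
    a * moyalTerm a abar p q c d 0 0 i k
      = moyalTerm a abar p q c d 1 0 i k
        - ((1 / 2 : ℂ) • moyalTerm a abar p (q - 1) c d 0 0 i k
          + (1 / 2 : ℂ) • moyalTerm a abar p q c (d - 1) 0 0 i k) := by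
  have e : moyalCoeff p (q - 1) c d i k + moyalCoeff p q c (d - 1) i k
      = (((q + d - i - k + 0 : ℤ)) : ℂ) * moyalCoeff p q c d i k := by
    have h1 := mul_invFact (q - i)
    have h2 := mul_invFact (d - k)
    rw [show q - i - 1 = q - 1 - i by ring] at h1
    rw [show d - k - 1 = d - 1 - k by ring] at h2
    push_cast at h1 h2
    rw [moyalCoeff, moyalCoeff, moyalCoeff, ← h1, ← h2]
    push_cast
    ring
  simp only [moyalTerm]
  rw [show q - 1 + d - i - k + 0 = q + d - i - k + 0 - 1 by ring,
    show q + (d - 1) - i - k + 0 = q + d - i - k + 0 - 1 by ring, ← smul_add, ← add_smul, e]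
  by_cases h0 : moyalCoeff p q c d i k = 0
  · simp [h0]
  obtain ⟨h1, _, h2, _⟩ := moyalCoeff_ne_zero h0
  rw [mul_smul_comm, a_mul_weylZ h _ (by omega), add_zero (_ - _ : ℤ), add_zero (_ - _ : ℤ)]
  module

/-- Summation by shifting the index: a weight `i / i!` moves `i` to `i + 1`. -/
lemma sum_range_eq_of_shift {V : Type*} [AddCommGroup V] {M : ℕ} {F G : ℕ → V} (h0 : F 0 = 0)
    (hs : ∀ i, F (i + 1) = G i) (hM : ∀ i, M ≤ i + 1 → G i = 0) :
    ∑ i ∈ Finset.range M, F i = ∑ i ∈ Finset.range M, G i := by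
  cases M with
  | zero => rfl
  | succ M =>
    rw [Finset.sum_range_succ', h0, add_zero, Finset.sum_range_succ, hM M le_rfl, add_zero]
    exact Finset.sum_congr rfl fun i _ => hs i

/-- The factor `q + 1 = (q + 1 - i) + i` is split between `1 / (q + 1 - i)!` and `1 / i!`; the
second part shifts `i`. -/
lemma moyalSum_succ_right {M : ℕ} (p q c d : ℤ) (hM : q + 1 < M) :
    ((q : ℂ) + 1) • moyalSum a abar M p (q + 1) c d 0 0
      = moyalSum a abar M p q c d 0 1 + (1 / 2 : ℂ) • moyalSum a abar M p q (c - 1) d 0 0 := by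
  have e1 : ∀ i k : ℕ, ((q : ℂ) + 1) • moyalTerm a abar p (q + 1) c d 0 0 i k
      = moyalTerm a abar p q c d 0 1 i k
        + (i : ℂ) • moyalTerm a abar p (q + 1) c d 0 0 i k := by
    intro i k
    have h1 := mul_invFact (q + 1 - i)
    rw [show q + 1 - i - 1 = q - i by ring] at h1
    push_cast at h1
    have : ((q : ℂ) + 1) * moyalCoeff p (q + 1) c d i k
        = moyalCoeff p q c d i k + i * moyalCoeff p (q + 1) c d i k := by
      simp only [moyalCoeff]
      rw [← h1]
      ring
    simp only [moyalTerm]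
    rw [show q + 1 + d - i - k + 0 = q + d - i - k + 1 by ring, smul_smul, this, add_smul, mul_smul]
  have e2 : ∑ i ∈ Finset.range M, ∑ k ∈ Finset.range M,
      (i : ℂ) • moyalTerm a abar p (q + 1) c d 0 0 i k
      = ∑ i ∈ Finset.range M, ∑ k ∈ Finset.range M,
        (1 / 2 : ℂ) • moyalTerm a abar p q (c - 1) d 0 0 i k := by
    refine sum_range_eq_of_shift (by simp) (fun i => ?_) (fun i hi => ?_)
    · refine Finset.sum_congr rfl fun k _ => ?_
      have h1 := mul_invFact ((i + 1 : ℕ) : ℤ)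
      rw [show ((i + 1 : ℕ) : ℤ) - 1 = i by push_cast; ring, Int.cast_natCast] at h1
      have : ((i + 1 : ℕ) : ℂ) * moyalCoeff p (q + 1) c d (i + 1) k
          = 1 / 2 * moyalCoeff p q (c - 1) d i k := by
        simp only [moyalCoeff]
        rw [← h1, show q + 1 - ((i + 1 : ℕ) : ℤ) = q - i by push_cast; ring,
          show c - ((i + 1 : ℕ) : ℤ) = c - 1 - i by push_cast; ring]
        ring
      simp only [moyalTerm]
      rw [smul_smul, this, ← smul_smul]
      congr 3 <;> push_cast <;> ring
    · refine Finset.sum_eq_zero fun k _ => ?_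
      rw [moyalTerm, moyalCoeff_eq_zero (by omega), zero_smul, smul_zero]
  simp only [moyalSum, Finset.smul_sum, e1, Finset.sum_add_distrib, e2]

/-- The factor `p + 1 = (p + 1 - k) + k` is split between `1 / (p + 1 - k)!` and `1 / k!`; the
second part shifts `k`. -/
lemma moyalSum_succ_left {M : ℕ} (p q c d : ℤ) (hM : p + 1 < M) :
    ((p : ℂ) + 1) • moyalSum a abar M (p + 1) q c d 0 0
      = moyalSum a abar M p q c d 1 0 - (1 / 2 : ℂ) • moyalSum a abar M p q c (d - 1) 0 0 := by
  have e1 : ∀ i k : ℕ, ((p : ℂ) + 1) • moyalTerm a abar (p + 1) q c d 0 0 i k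
      = moyalTerm a abar p q c d 1 0 i k
        + (k : ℂ) • moyalTerm a abar (p + 1) q c d 0 0 i k := by
    intro i k
    have h1 := mul_invFact (p + 1 - k)
    rw [show p + 1 - k - 1 = p - k by ring] at h1
    push_cast at h1
    have : ((p : ℂ) + 1) * moyalCoeff (p + 1) q c d i k
        = moyalCoeff p q c d i k + k * moyalCoeff (p + 1) q c d i k := by
      simp only [moyalCoeff]
      rw [← h1]
      ring
    simp only [moyalTerm]
    rw [show p + 1 + c - i - k + 0 = p + c - i - k + 1 by ring, smul_smul, this, add_smul, mul_smul]
  have e2 : ∀ i, ∑ k ∈ Finset.range M,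
      (k : ℂ) • moyalTerm a abar (p + 1) q c d 0 0 i k
      = ∑ k ∈ Finset.range M,
        (-1 / 2 : ℂ) • moyalTerm a abar p q c (d - 1) 0 0 i k := by
    intro i
    refine sum_range_eq_of_shift (by simp) (fun k => ?_) (fun k hk => ?_)
    · have h1 := mul_invFact ((k + 1 : ℕ) : ℤ)
      rw [show ((k + 1 : ℕ) : ℤ) - 1 = k by push_cast; ring, Int.cast_natCast] at h1
      have : ((k + 1 : ℕ) : ℂ) * moyalCoeff (p + 1) q c d i (k + 1)
          = -1 / 2 * moyalCoeff p q c (d - 1) i k := by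
        simp only [moyalCoeff]
        rw [← h1, show p + 1 - ((k + 1 : ℕ) : ℤ) = p - k by push_cast; ring,
          show d - ((k + 1 : ℕ) : ℤ) = d - 1 - k by push_cast; ring]
        ring
      simp only [moyalTerm]
      rw [smul_smul, this, ← smul_smul]
      congr 3 <;> push_cast <;> ring
    · rw [moyalTerm, moyalCoeff_eq_zero (by omega), zero_smul, smul_zero]
  simp only [moyalSum, Finset.smul_sum, e1, Finset.sum_add_distrib, e2]
  simp only [show (-1 / 2 : ℂ) = -(1 / 2) by norm_num, neg_smul, Finset.sum_neg_distrib,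
    ← sub_eq_add_neg]

lemma abar_mul_moyalSum {M : ℕ} (p q c d : ℤ) (hM : q + 1 < M) :
    abar * moyalSum a abar M p q c d 0 0
      = ((q : ℂ) + 1) • moyalSum a abar M p (q + 1) c d 0 0
        + (1 / 2 : ℂ) • moyalSum a abar M (p - 1) q c d 0 0 := by
  rw [moyalSum_succ_right p q c d hM]
  simp only [moyalSum, Finset.mul_sum, abar_mul_moyalTerm, Finset.sum_add_distrib, Finset.smul_sum]
  abel

lemma a_mul_moyalSum (h : abar * a - a * abar = 1) {M : ℕ} (p c d : ℤ) (hM : p + 1 < M) :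
    a * moyalSum a abar M p 0 c d 0 0
      = ((p : ℂ) + 1) • moyalSum a abar M (p + 1) 0 c d 0 0 := by
  have h0 : moyalSum a abar M p (0 - 1) c d 0 0 = 0 := by
    refine Finset.sum_eq_zero fun i _ => Finset.sum_eq_zero fun k _ => ?_
    rw [moyalTerm, moyalCoeff_eq_zero (by omega), zero_smul]
  rw [moyalSum_succ_left p 0 c d hM]
  simp only [moyalSum] at h0 ⊢
  simp only [Finset.mul_sum, a_mul_moyalTerm h, Finset.sum_add_distrib, Finset.smul_sum,
    Finset.sum_sub_distrib]
  simp only [← Finset.smul_sum, h0, smul_zero, zero_add]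

/-- The product of two symmetrized monomials is given by the Moyal formula. The formula satisfies
the same recursions under left multiplication by `a` and `ā` as the product does, which reduces it
to the case where the left factor is `1`. -/
lemma weylMono_mul_weylMono (h : abar * a - a * abar = 1) {M p q : ℕ} (c d : ℕ) (hp : p < M)
    (hq : q < M) :
    (1 / ((p ! : ℂ) * q ! * c ! * d !)) • (weylMono a abar p q * weylMono a abar c d)
      = moyalSum a abar M p q c d 0 0 := by
  induction q generalizing p with
  | zero =>
    induction p with
    | zero =>
      rw [moyalSum, Finset.sum_eq_single_of_mem 0 (by simpa using hp),
        Finset.sum_eq_single_of_mem 0 (by simpa using hp)]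
      · simp [moyalTerm, moyalCoeff, weylZ_natCast, invFact_natCast, weylMono,
          show invFact 0 = 1 by simpa using invFact_natCast 0, mul_comm]
      · intro k _ hk
        rw [moyalTerm, moyalCoeff_eq_zero (by omega), zero_smul]
      · intro i _ hi
        refine Finset.sum_eq_zero fun k _ => ?_
        rw [moyalTerm, moyalCoeff_eq_zero (by omega), zero_smul]
    | succ p ih =>
      have e := a_mul_moyalSum h (M := M) p c d (by exact_mod_cast hp)
      have ih' := ih (by omega)
      rw [Nat.cast_zero] at ih' ⊢
      have h1 : ((p : ℂ) + 1) ≠ 0 := by exact_mod_cast Nat.succ_ne_zero p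
      rw [← ih', weylMono, mul_smul_comm, ← mul_assoc, ← pow_succ', Int.cast_natCast] at e
      rw [Nat.cast_succ, ← inv_smul_smul₀ h1 (moyalSum a abar M ((p : ℤ) + 1) 0 c d 0 0), ← e,
        smul_smul, Nat.factorial_succ, weylMono]
      congr 1
      push_cast
      field_simp
  | succ q ih =>
    have e := abar_mul_moyalSum (a := a) (abar := abar) (M := M) p q c d (by exact_mod_cast hq)
    have h1 : ((q : ℂ) + 1) ≠ 0 := by exact_mod_cast Nat.succ_ne_zero q
    have h2 : moyalSum a abar M ((p : ℤ) - 1) q c d 0 0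
        = ((p : ℂ) / ((p ! : ℂ) * q ! * c ! * d !))
          • (weylMono a abar (p - 1) q * weylMono a abar c d) := by
      cases p with
      | zero =>
        simp only [Nat.cast_zero, zero_div, zero_smul]
        refine Finset.sum_eq_zero fun i _ => Finset.sum_eq_zero fun k _ => ?_
        rw [moyalTerm, moyalCoeff_eq_zero (by omega), zero_smul]
      | succ p =>
        rw [Nat.cast_succ, add_sub_cancel_right, ← ih (by omega) (by omega), Nat.add_sub_cancel,
          Nat.factorial_succ]
        have h3 : ((p : ℂ) + 1) ≠ 0 := by exact_mod_cast Nat.succ_ne_zero p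
        congr 1
        push_cast
        field_simp
    have e' : moyalSum a abar M p ((q : ℤ) + 1) c d 0 0 = ((q : ℂ) + 1)⁻¹ •
        (abar * moyalSum a abar M p q c d 0 0
          - (1 / 2 : ℂ) • moyalSum a abar M ((p : ℤ) - 1) q c d 0 0) := by
      rw [e, add_sub_cancel_right, Int.cast_natCast, inv_smul_smul₀ h1]
    rw [Nat.cast_succ, e', h2, ← ih hp (by omega), weylMono, sub_mul, smul_mul_assoc,
      mul_smul_comm, ← mul_assoc, Nat.factorial_succ, smul_sub, smul_sub, smul_smul, smul_smul,
      smul_smul, smul_smul]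
    congr 2 <;> push_cast <;> field_simp

end Moyal

/-! ### Commutation relations with `e^{tσ}` in the boson realization -/

section Boson

variable {W : Type*} [Ring W] [Algebra ℂ W] {a abar : W}

lemma commute_a_bosJp (a : W) : Commute a (bosJp a) := by
  rw [bosJp]
  exact (((Commute.refl a).pow_right 2).smul_right _).neg_right

lemma commute_a_expSigma (a : W) (t : ℂ) :
    PowerSeries.C a * expSigma (bosJp a) t = expSigma (bosJp a) t * PowerSeries.C a :=
  commute_C_expSigma (commute_a_bosJp a) t

lemma abar_mul_bosJp_pow (h : abar * a - a * abar = 1) (n : ℕ) :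
    abar * bosJp a ^ n = bosJp a ^ n * abar - (n : ℂ) • (a * bosJp a ^ (n - 1)) := by
  have h' : abar * a = a * abar + 1 := by rw [← h]; abel
  have h1 : abar * bosJp a = bosJp a * abar - a := by
    have : abar * a ^ 2 = a ^ 2 * abar + (2 : ℂ) • a := by
      simpa using abar_mul_pow h 2
    rw [bosJp, mul_neg, mul_smul_comm, this, neg_mul, smul_mul_assoc]
    module
  induction n with
  | zero => simp
  | succ n ih =>
    have e : (n : ℂ) • (a * bosJp a ^ (n - 1) * bosJp a) = (n : ℂ) • (a * bosJp a ^ n) := by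
      cases n with
      | zero => simp
      | succ n => rw [Nat.add_sub_cancel, mul_assoc, ← pow_succ]
    rw [pow_succ, ← mul_assoc, ih, sub_mul, mul_assoc, h1, smul_mul_assoc, e, mul_sub,
      ← mul_assoc, Nat.add_sub_cancel, ((commute_a_bosJp a).pow_right n).eq]
    push_cast
    module

/-- `[ā, f(h J₊)] = -h a f'(h J₊)`. -/
lemma abar_mul_scaleHom (h : abar * a - a * abar = 1) (f : PowerSeries ℂ) :
    PowerSeries.C abar * scaleHom (bosJp a) f
      = scaleHom (bosJp a) f * PowerSeries.C abar
        - PowerSeries.X * (PowerSeries.C a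
          * scaleHom (bosJp a) (PowerSeries.derivative ℂ f)) := by
  ext n
  rw [map_sub, PowerSeries.coeff_C_mul, PowerSeries.coeff_mul_C, coeff_scaleHom, mul_smul_comm,
    smul_mul_assoc, abar_mul_bosJp_pow h]
  cases n with
  | zero => simp
  | succ n =>
    rw [PowerSeries.coeff_succ_X_mul, PowerSeries.coeff_C_mul, coeff_scaleHom,
      PowerSeries.coeff_derivative, Nat.add_sub_cancel, mul_smul_comm]
    push_cast
    module

/-- `[ā, e^{tσ}] = -2th a e^{(t+1)σ}`. -/
lemma abar_mul_expSigma (h : abar * a - a * abar = 1) (t : ℂ) :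
    PowerSeries.C abar * expSigma (bosJp a) t
      = expSigma (bosJp a) t * PowerSeries.C abar
        - (2 * t) • (PowerSeries.X * (PowerSeries.C a * expSigma (bosJp a) (t + 1))) := by
  rw [← scaleHom_expSigma, abar_mul_scaleHom h, derivative_expSigma_one, map_smul,
    scaleHom_expSigma _ (t + 1), mul_smul_comm, mul_smul_comm]

lemma C_smul (c : ℂ) (x : W) : PowerSeries.C (c • x) = c • PowerSeries.C x := by
  ext n
  rw [PowerSeries.coeff_smul, PowerSeries.coeff_C, PowerSeries.coeff_C]
  split_ifs <;> simp

/-- `h a² = e^{-σ} - 1`. -/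
lemma X_mul_a_mul_a (a : W) :
    PowerSeries.X * (PowerSeries.C a * PowerSeries.C a) = expSigma (bosJp a) (-1) - 1 := by
  have : PowerSeries.C (bosJp a)
      = -((1 / 2 : ℂ) • (PowerSeries.C a * PowerSeries.C a : PowerSeries W)) := by
    rw [bosJp, map_neg, C_smul, pow_two, map_mul]
  rw [expSigma_neg_one, this, mul_neg, mul_smul_comm]
  module

lemma X_mul_a_mul_a_mul_expSigma (a : W) (t : ℂ) :
    PowerSeries.X * (PowerSeries.C a * (PowerSeries.C a * expSigma (bosJp a) (t + 1)))
      = expSigma (bosJp a) t - expSigma (bosJp a) (t + 1) := by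
  rw [← mul_assoc (PowerSeries.C a), ← mul_assoc, X_mul_a_mul_a, sub_mul, one_mul, expSigma_mul,
    neg_add_cancel_comm_assoc]

lemma C_bosJ0 (h : abar * a - a * abar = 1) :
    PowerSeries.C (bosJ0 a abar)
      = PowerSeries.C a * PowerSeries.C abar + (1 / 2 : ℂ) • (1 : PowerSeries W) := by
  have h' : abar * a = a * abar + 1 := by rw [← h]; abel
  rw [← map_mul, ← map_one (PowerSeries.C (R := W)), ← C_smul, ← map_add, bosJ0, h']
  congr 1
  module

/-- `[J₀, e^{tσ}] = 2t (e^{(t+1)σ} - e^{tσ})`. -/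
lemma bosJ0_mul_expSigma (h : abar * a - a * abar = 1) (t : ℂ) :
    PowerSeries.C (bosJ0 a abar) * expSigma (bosJp a) t
      = expSigma (bosJp a) t * PowerSeries.C (bosJ0 a abar)
        + (2 * t) • (expSigma (bosJp a) (t + 1) - expSigma (bosJp a) t) := by
  rw [C_bosJ0 h, add_mul, mul_assoc, abar_mul_expSigma h, mul_sub, ← mul_assoc,
    commute_a_expSigma, mul_add, mul_smul_comm, ← mul_assoc _ PowerSeries.X,
    (PowerSeries.commute_X (PowerSeries.C a)).eq, mul_assoc PowerSeries.X,
    X_mul_a_mul_a_mul_expSigma, mul_assoc, smul_mul_assoc, mul_smul_comm, one_mul, mul_one]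
  module

lemma bosJm_mul_expSigma (h : abar * a - a * abar = 1) (t : ℂ) :
    PowerSeries.C (bosJm abar) * expSigma (bosJp a) t
      = expSigma (bosJp a) t * PowerSeries.C (bosJm abar)
        - (2 * t) • (PowerSeries.X * (PowerSeries.C (bosJ0 a abar) * expSigma (bosJp a) (t + 1)))
        - (2 * t * (t + 1)) • (PowerSeries.X *
            (expSigma (bosJp a) (t + 1) - expSigma (bosJp a) (t + 2))) := by
  have hJm : PowerSeries.C (bosJm abar)
      = (1 / 2 : ℂ) • (PowerSeries.C abar * PowerSeries.C abar : PowerSeries W) := by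
    rw [bosJm, C_smul, pow_two, map_mul]
  have hba : PowerSeries.C abar * PowerSeries.C a
      = PowerSeries.C a * PowerSeries.C abar + (1 : PowerSeries W) := by
    rw [← map_mul, ← map_mul, ← map_one (PowerSeries.C (R := W)), ← map_add, ← h]
    congr 1
    abel
  have hE : ∀ s : ℂ, expSigma (bosJp a) s * PowerSeries.C abar
      = PowerSeries.C abar * expSigma (bosJp a) s
        + (2 * s) • (PowerSeries.X * (PowerSeries.C a * expSigma (bosJp a) (s + 1))) := by
    intro s
    rw [abar_mul_expSigma h]
    abel
  have e1 : PowerSeries.C abar * (PowerSeries.X * (PowerSeries.C a * expSigma (bosJp a) (t + 1)))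
      = PowerSeries.X * (PowerSeries.C a * (PowerSeries.C abar * expSigma (bosJp a) (t + 1)))
        + PowerSeries.X * expSigma (bosJp a) (t + 1) := by
    rw [← mul_assoc _ PowerSeries.X, (PowerSeries.commute_X (PowerSeries.C abar)).eq, mul_assoc,
      ← mul_assoc _ (PowerSeries.C a), hba, add_mul, one_mul, mul_add, mul_assoc]
  have e2 : PowerSeries.X * (PowerSeries.C a * expSigma (bosJp a) (t + 1)) * PowerSeries.C abar
      = PowerSeries.X * (PowerSeries.C a * (PowerSeries.C abar * expSigma (bosJp a) (t + 1)))
        + (2 * (t + 1)) • (PowerSeries.X *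
            (expSigma (bosJp a) (t + 1) - expSigma (bosJp a) (t + 2))) := by
    rw [mul_assoc, mul_assoc, hE, mul_add, mul_add, mul_smul_comm, mul_smul_comm,
      ← mul_assoc (PowerSeries.C a) PowerSeries.X,
      (PowerSeries.commute_X (PowerSeries.C a)).eq, mul_assoc PowerSeries.X,
      X_mul_a_mul_a_mul_expSigma, add_assoc t, one_add_one_eq_two]
  rw [C_bosJ0 h, hJm, smul_mul_assoc, mul_assoc, abar_mul_expSigma h, mul_sub, ← mul_assoc,
    abar_mul_expSigma h, sub_mul, mul_smul_comm, smul_mul_assoc, e1, e2, mul_smul_comm,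
    ← mul_assoc (expSigma _ _)]
  simp only [add_mul, smul_mul_assoc, one_mul, mul_add, mul_smul_comm, mul_assoc]
  module

/-- For a weight vector `t = Q e^{mσ}`, where `Q` does not involve `h`, the deformed lowering
operator acts through the undeformed one on `Q`. With `J₀` moved to the
right of `t`, the correction terms are multiples of `h t J₀`, `h t e^{σ}`, `h t` and `h t e^{-σ}`,
and they cancel. -/
lemma adJm_mul_expSigma (h : abar * a - a * abar = 1) (Q : W) (m : ℂ)
    (hw : adJ0 (bosJp a) (bosJ0 a abar) (PowerSeries.C Q * expSigma (bosJp a) m)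
      = (2 * m) • (PowerSeries.C Q * expSigma (bosJp a) m)) :
    adJm (bosJp a) (bosJ0 a abar) (bosJm abar) (PowerSeries.C Q * expSigma (bosJp a) m)
      = PowerSeries.C (bosJm abar * Q - Q * bosJm abar) * expSigma (bosJp a) (m - 1) := by
  set t := PowerSeries.C Q * expSigma (bosJp a) m with ht
  set H := PowerSeries.C (bosJ0 a abar) with hH
  -- `[J₀, t] = 2m t e^σ`
  have f1 : H * t - t * H = (2 * m) • (t * expSigma (bosJp a) 1) := by
    have := congrArg (· * expSigma (bosJp a) 1) hw
    simp only [adJ0, comm] at this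
    rwa [mul_assoc, expSigma_mul, neg_add_cancel, expSigma_zero, mul_one, smul_mul_assoc] at this
  have f1' : H * t = t * H + (2 * m) • (t * expSigma (bosJp a) 1) := by rw [← f1]; abel
  have hE1 : expSigma (bosJp a) 1 * H = H * expSigma (bosJp a) 1
      - (2 : ℂ) • (expSigma (bosJp a) 2 - expSigma (bosJp a) 1) := by
    rw [hH, bosJ0_mul_expSigma h, mul_one, one_add_one_eq_two]
    abel
  have f2 : H * (t * expSigma (bosJp a) 1) - t * expSigma (bosJp a) 1 * H
      = (2 : ℂ) • (t * expSigma (bosJp a) 2 - t * expSigma (bosJp a) 1)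
        + (2 * m) • (t * expSigma (bosJp a) 2) := by
    rw [← mul_assoc, f1', mul_assoc t _ H, hE1, add_mul, smul_mul_assoc,
      mul_assoc t _ (expSigma _ 1), mul_assoc t _ (expSigma _ 1), expSigma_mul,
      one_add_one_eq_two, mul_sub, mul_smul_comm, mul_sub]
    module
  have f3 : PowerSeries.C (bosJ0 a abar ^ 2) * t - t * PowerSeries.C (bosJ0 a abar ^ 2)
      = (2 * m) • ((2 : ℂ) • (t * (H * expSigma (bosJp a) 1))
        + ((2 * m) • (t * expSigma (bosJp a) 2)
          - (2 : ℂ) • (t * expSigma (bosJp a) 2 - t * expSigma (bosJp a) 1))) := by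
    have e1 : H * H * t - t * (H * H) = (H * (H * t - t * H) - (H * t - t * H) * H)
        + (2 : ℂ) • ((H * t - t * H) * H) := by
      rw [two_smul]
      simp only [mul_sub, sub_mul, mul_assoc]
      abel
    rw [pow_two, map_mul, ← hH, e1, f1, mul_smul_comm, smul_mul_assoc, ← smul_sub, f2,
      mul_assoc t _ H, hE1, mul_sub, mul_smul_comm, mul_sub]
    module
  have f4 : PowerSeries.C (bosJm abar) * t - t * PowerSeries.C (bosJm abar)
      = PowerSeries.C (bosJm abar * Q - Q * bosJm abar) * expSigma (bosJp a) m
        - (2 * m) • (PowerSeries.X * (t * (H * expSigma (bosJp a) 1)))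
        - (2 * m) • (PowerSeries.X *
            ((2 * m) • (t * expSigma (bosJp a) 2 - t * expSigma (bosJp a) 1)))
        - (2 * m * (m + 1)) • (PowerSeries.X *
            (t * expSigma (bosJp a) 1 - t * expSigma (bosJp a) 2)) := by
    have hX : ∀ y : PowerSeries W, PowerSeries.C Q * (PowerSeries.X * y)
        = PowerSeries.X * (PowerSeries.C Q * y) := by
      intro y
      rw [← mul_assoc, (PowerSeries.commute_X (PowerSeries.C Q)).eq, mul_assoc]
    have hHm : H * expSigma (bosJp a) (m + 1) = expSigma (bosJp a) m * (H * expSigma (bosJp a) 1)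
        + (2 * m) • (expSigma (bosJp a) (m + 2) - expSigma (bosJp a) (m + 1)) := by
      have : H * expSigma (bosJp a) m = expSigma (bosJp a) m * H
        + (2 * m) • (expSigma (bosJp a) (m + 1) - expSigma (bosJp a) m) := bosJ0_mul_expSigma h m
      rw [← expSigma_mul, ← mul_assoc, this, add_mul, smul_mul_assoc, sub_mul, expSigma_mul,
        expSigma_mul, mul_assoc, add_assoc m, one_add_one_eq_two]
    have e := congrArg (PowerSeries.C Q * ·) (bosJm_mul_expSigma (a := a) h m)
    simp only [← hH, hHm] at e
    rw [ht, mul_assoc, ← sub_eq_zero]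
    rw [← sub_eq_zero] at e
    rw [← e]
    simp only [map_sub, map_mul, mul_sub, sub_mul, mul_smul_comm, mul_add, hX, mul_assoc,
      expSigma_mul]
    module
  have hX : ∀ y : PowerSeries W, t * (PowerSeries.X * y) = PowerSeries.X * (t * y) := by
    intro y
    rw [← mul_assoc, (PowerSeries.commute_X t).eq, mul_assoc]
  have e0 : comm (PowerSeries.C (bosJm abar) + PowerSeries.X * H
      + (1 / 2 : ℂ) • (PowerSeries.X * PowerSeries.C (bosJ0 a abar ^ 2))) t
      = (PowerSeries.C (bosJm abar) * t - t * PowerSeries.C (bosJm abar))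
        + PowerSeries.X * (H * t - t * H)
        + (1 / 2 : ℂ) • (PowerSeries.X * (PowerSeries.C (bosJ0 a abar ^ 2) * t
          - t * PowerSeries.C (bosJ0 a abar ^ 2))) := by
    simp only [comm, add_mul, mul_add, smul_mul_assoc, mul_smul_comm, hX, mul_sub, mul_assoc]
    module
  have e1 : comm H t = (2 * m) • (t * expSigma (bosJp a) 1) := f1
  have e2 : comm H (comm H t) = (2 * m) • ((2 : ℂ) • (t * expSigma (bosJp a) 2
      - t * expSigma (bosJp a) 1) + (2 * m) • (t * expSigma (bosJp a) 2)) := by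
    rw [e1, comm, mul_smul_comm, smul_mul_assoc, ← smul_sub, f2]
  rw [adJm, e0, f1, f3, f4, e2, e1]
  simp only [sub_mul, add_mul, smul_mul_assoc, mul_smul_comm, mul_assoc, mul_sub, mul_add,
    expSigma_mul, smul_add, smul_sub]
  norm_num
  simp only [← sub_eq_add_neg]
  module

end Boson

/-! ### The `h`-symplecton in terms of symmetrized monomials -/

section Symplecton

variable {W : Type*} [Ring W] [Algebra ℂ W] {a abar : W}

lemma expSigma_pow (x : W) (t : ℂ) (n : ℕ) : expSigma x t ^ n = expSigma x (n * t) := by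
  induction n with
  | zero => simp [expSigma_zero]
  | succ n ih =>
    rw [pow_succ, ih, expSigma_mul]
    congr 1
    push_cast
    ring

lemma ah_pow (a : W) (n : ℕ) :
    ah a ^ n = PowerSeries.C (a ^ n) * expSigma (bosJp a) ((n : ℂ) / 2) := by
  have : Commute (PowerSeries.C a) (expSigma (bosJp a) (1 / 2)) := commute_a_expSigma a _
  rw [ah, this.mul_pow, expSigma_pow, map_pow]
  congr 2
  ring

/-- The coefficient `N_j / √((j+m)! (j-m)!)` of the symmetrized monomial `a^{j+m} ā^{j-m}` in
`P̃_j^m`, with `u = j + m` and `v = j - m`. -/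
def normCoeff (N : ℂ) (u v : ℕ) : ℂ := N / (Real.sqrt ((u ! : ℝ) * v !) : ℂ)

lemma ladder_neg_wt (u v : ℕ) :
    ladder (u + v) (-((u : ℤ) - v)) = Real.sqrt ((u : ℝ) * (v + 1)) := by
  rw [ladder]
  congr 1
  push_cast
  ring

/-- The factor `u + 1` from `[ā²/2, ·]` turns one normalization into the next, up to the coefficient
of the ladder. -/
lemma normCoeff_succ (N : ℂ) (u v : ℕ) :
    normCoeff N (u + 1) v * ((u : ℂ) + 1)
      = (Real.sqrt (((u + 1 : ℕ) : ℝ) * (v + 1)) : ℂ) * normCoeff N u (v + 1) := by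
  have h1 : Real.sqrt (((u + 1)! : ℝ) * v !) * Real.sqrt (((u + 1 : ℕ) : ℝ) * (v + 1))
      = ((u : ℝ) + 1) * Real.sqrt ((u ! : ℝ) * (v + 1)!) := by
    have h0 : (0 : ℝ) ≤ (u : ℝ) + 1 := by positivity
    rw [← Real.sqrt_mul (by positivity)]
    conv_rhs => rw [← Real.sqrt_sq h0]
    rw [← Real.sqrt_mul (by positivity), Nat.factorial_succ, Nat.factorial_succ]
    congr 1
    push_cast
    ring
  have h2 : (Real.sqrt (((u + 1)! : ℝ) * v !) : ℂ) ≠ 0 := by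
    exact_mod_cast (Real.sqrt_pos.2 (by positivity)).ne'
  have h3 : (Real.sqrt ((u ! : ℝ) * (v + 1)!) : ℂ) ≠ 0 := by
    exact_mod_cast (Real.sqrt_pos.2 (by positivity)).ne'
  have h1' := congrArg (fun x : ℝ => (x : ℂ)) h1
  simp only [Complex.ofReal_mul, Complex.ofReal_add, Complex.ofReal_natCast,
    Complex.ofReal_one] at h1'
  rw [normCoeff, normCoeff]
  field_simp
  push_cast at h1' ⊢
  linear_combination -N * h1'

/-- `P̃_j^m = (N_j / √((j+m)! (j-m)!)) a^{j+m} ā^{j-m} e^{mσ}`, with a symmetrized monomial: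
twisting multiplies an undeformed tensor operator of weight `m` by `e^{mσ}`. -/
lemma IsHSymplecton.eq_weylMono (h : abar * a - a * abar = 1) {N : ℕ → ℂ}
    {P : ℕ → ℤ → PowerSeries W} (hP : IsHSymplecton a abar N P) (u v : ℕ) :
    P (u + v) ((u : ℤ) - v)
      = PowerSeries.C (normCoeff (N (u + v)) u v • weylMono a abar u v)
        * expSigma (bosJp a) (((u : ℂ) - v) / 2) := by
  induction v generalizing u with
  | zero =>
    have := hP.top u
    rw [Nat.add_zero, Nat.cast_zero, sub_zero, this, ah_pow, C_smul, weylMono, normCoeff,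
      smul_mul_assoc]
    simp
  | succ v ih =>
    have ih' := ih (u + 1)
    have hlt : v < u + 1 + v + 1 := by omega
    have hwt : wt (u + 1 + v) ⟨v, hlt⟩ = ((u + 1 : ℕ) : ℤ) - v := by
      simp only [wt]
      push_cast
      ring
    have hw := hP.weight (u + 1 + v) ⟨v, hlt⟩
    have hl := hP.lower (u + 1 + v) ⟨v, hlt⟩
    rw [hwt] at hw hl
    rw [ih'] at hw hl
    rw [adJm_mul_expSigma h] at hl
    · rw [ladder_neg_wt, mul_smul_comm, smul_mul_assoc, ← smul_sub, bosJm_comm_weylMono h,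
        smul_smul, Nat.add_sub_cancel, Nat.cast_succ (R := ℂ), normCoeff_succ, mul_smul, C_smul,
        smul_mul_assoc] at hl
      have hne : (Real.sqrt (((u + 1 : ℕ) : ℝ) * (v + 1)) : ℂ) ≠ 0 := by
        exact_mod_cast (Real.sqrt_pos.2 (by positivity)).ne'
      have hl' := smul_right_injective _ hne hl
      rw [show u + (v + 1) = u + 1 + v by ring,
        show (u : ℤ) - ((v + 1 : ℕ) : ℤ) = ((u + 1 : ℕ) : ℤ) - v - 2 by push_cast; ring, ← hl']
      congr 2
      push_cast
      ring
    · rw [hw]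
      congr 1
      push_cast
      ring

lemma IsHSymplecton.eq_weylMono_wt (h : abar * a - a * abar = 1) {N : ℕ → ℂ}
    {P : ℕ → ℤ → PowerSeries W} (hP : IsHSymplecton a abar N P) (J : ℕ) (m : Fin (J + 1)) :
    P J (wt J m)
      = PowerSeries.C (normCoeff (N J) (J - m) m • weylMono a abar (J - m) m)
        * expSigma (bosJp a) ((wt J m : ℂ) / 2) := by
  have hm : (m : ℕ) ≤ J := Nat.lt_succ_iff.1 m.2
  have e := hP.eq_weylMono h (J - m) m
  have hwt : wt J m = ((J - m : ℕ) : ℤ) - ((m : ℕ) : ℤ) := by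
    rw [wt, Nat.cast_sub hm]; ring
  rw [Nat.sub_add_cancel hm, ← hwt] at e
  rw [e, hwt]
  congr 3
  push_cast
  ring

end Symplecton

/-! ### Conjugation by `e^{sσ}` -/

section PolynomialFunctions

variable {V : Type*} [AddCommGroup V] [Module ℂ V]

/-- A function `ℂ → V` all of whose linear functionals are polynomials. -/
def IsPolyFun (g : ℂ → V) : Prop :=
  ∀ L : Module.Dual ℂ V, ∃ p : Polynomial ℂ, ∀ s, L (g s) = p.eval s

lemma IsPolyFun.sub {f g : ℂ → V} (hf : IsPolyFun f) (hg : IsPolyFun g) :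
    IsPolyFun fun s => f s - g s := by
  intro L
  obtain ⟨p, hp⟩ := hf L
  obtain ⟨q, hq⟩ := hg L
  exact ⟨p - q, fun s => by rw [map_sub, hp, hq, Polynomial.eval_sub]⟩

lemma IsPolyFun.sum {ι : Type*} (S : Finset ι) {f : ι → ℂ → V} (hf : ∀ i ∈ S, IsPolyFun (f i)) :
    IsPolyFun fun s => ∑ i ∈ S, f i s := by
  intro L
  have : ∀ i, ∃ p : Polynomial ℂ, i ∈ S → ∀ s, L (f i s) = p.eval s := by
    intro i
    by_cases hi : i ∈ S
    · obtain ⟨p, hp⟩ := hf i hi L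
      exact ⟨p, fun _ => hp⟩
    · exact ⟨0, fun h => absurd h hi⟩
  choose p hp using this
  refine ⟨∑ i ∈ S, p i, fun s => ?_⟩
  rw [map_sum, Polynomial.eval_finsetSum]
  exact Finset.sum_congr rfl fun i hi => hp i hi s

lemma isPolyFun_smul (p : Polynomial ℂ) (w : V) : IsPolyFun fun s => p.eval s • w := by
  intro L
  refine ⟨p * Polynomial.C (L w), fun s => ?_⟩
  rw [map_smul, smul_eq_mul, Polynomial.eval_mul, Polynomial.eval_C]

/-- A polynomial function that vanishes on the natural numbers vanishes. -/
lemma IsPolyFun.eq_zero {g : ℂ → V} (hg : IsPolyFun g) (h0 : ∀ n : ℕ, g n = 0) (s : ℂ) :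
    g s = 0 := by
  rw [← Module.forall_dual_apply_eq_zero_iff ℂ]
  intro L
  obtain ⟨p, hp⟩ := hg L
  have : p = 0 := by
    apply Polynomial.eq_zero_of_infinite_isRoot
    refine (Set.infinite_range_of_injective (Nat.cast_injective (R := ℂ))).mono ?_
    rintro _ ⟨n, rfl⟩
    rw [Set.mem_ofPred_eq, Polynomial.IsRoot.def, ← hp, h0, map_zero]
  rw [hp, this, Polynomial.eval_zero]

end PolynomialFunctions

section Conjugation

/-- The polynomial in `t` which is the coefficient of `h^n` in `(1 - 2h)^{-t}`. -/
def powPoly (n : ℕ) : Polynomial ℂ := Polynomial.C (2 ^ n / (n ! : ℂ)) * ascPochhammer ℂ n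

lemma coeff_expSigma_powPoly {A : Type*} [Ring A] [Algebra ℂ A] (x : A) (t : ℂ) (n : ℕ) :
    PowerSeries.coeff n (expSigma x t) = (powPoly n).eval t • x ^ n := by
  rw [coeff_expSigma, powPoly, Polynomial.eval_mul, Polynomial.eval_C]

/-- The matrix of `e^{tσ}` on `V^j`, with entries in `ℂ⟦h⟧`. -/
def sigmaMatrix (J : ℕ) (t : ℂ) : Matrix (Fin (J + 1)) (Fin (J + 1)) (PowerSeries ℂ) :=
  Matrix.of fun k m => PowerSeries.mk fun n =>
    PowerSeries.coeff n (expSigma (matJp J) t) k m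

lemma sigmaMatrix_mul (J : ℕ) (s t : ℂ) :
    sigmaMatrix J s * sigmaMatrix J t = sigmaMatrix J (s + t) := by
  ext k m n
  rw [Matrix.mul_apply, map_sum]
  simp only [sigmaMatrix, Matrix.of_apply, PowerSeries.coeff_mul, PowerSeries.coeff_mk]
  rw [← expSigma_mul, PowerSeries.coeff_mul, Finset.sum_comm, Matrix.sum_apply]
  exact Finset.sum_congr rfl fun p _ => (Matrix.mul_apply).symm

lemma sigmaMatrix_zero (J : ℕ) : sigmaMatrix J 0 = 1 := by
  ext k m n
  rw [sigmaMatrix, Matrix.of_apply, PowerSeries.coeff_mk, expSigma_zero, PowerSeries.coeff_one,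
    Matrix.one_apply]
  obtain rfl | hk := eq_or_ne k m
  · by_cases hn : n = 0 <;> simp [hn, PowerSeries.coeff_one]
  · by_cases hn : n = 0 <;> simp [hn, hk]

lemma sigmaMatrix_neg_one (J : ℕ) (k m : Fin (J + 1)) :
    sigmaMatrix J (-1) k m
      = (1 : Matrix (Fin (J + 1)) (Fin (J + 1)) (PowerSeries ℂ)) k m
        - (2 * matJp J k m) • PowerSeries.X := by
  ext n
  rw [sigmaMatrix, Matrix.of_apply, PowerSeries.coeff_mk, expSigma_neg_one, map_sub,
    PowerSeries.coeff_one, Matrix.one_apply, map_sub, PowerSeries.coeff_smul,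
    PowerSeries.coeff_mul_C, PowerSeries.coeff_smul, PowerSeries.coeff_X, PowerSeries.coeff_X]
  by_cases hn : n = 0 <;> by_cases hn1 : n = 1 <;> by_cases hk : k = m <;>
    simp [hn, hn1, hk, PowerSeries.coeff_one]

variable {W : Type*} [Ring W] [Algebra ℂ W]

lemma coeff_scal_mul (f : PowerSeries ℂ) (t : PowerSeries W) (n : ℕ) :
    PowerSeries.coeff n (scal W f * t)
      = ∑ p ∈ Finset.HasAntidiagonal.antidiagonal n,
          PowerSeries.coeff p.1 f • PowerSeries.coeff p.2 t := by
  rw [PowerSeries.coeff_mul]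
  refine Finset.sum_congr rfl fun p _ => ?_
  rw [scal, PowerSeries.coeff_map, Algebra.smul_def]

lemma scal_commute (f : PowerSeries ℂ) (t : PowerSeries W) : Commute (scal W f) t := by
  ext n
  rw [coeff_scal_mul, PowerSeries.coeff_mul, ← Finset.Nat.sum_antidiagonal_swap]
  refine Finset.sum_congr rfl fun p _ => ?_
  rw [scal, PowerSeries.coeff_map, Prod.fst_swap, Prod.snd_swap, Algebra.smul_def,
    Algebra.commutes]

lemma scal_one : scal W 1 = 1 := map_one _

lemma scal_zero : scal W 0 = 0 := map_zero _

lemma scal_mul (f g : PowerSeries ℂ) : scal W (f * g) = scal W f * scal W g := map_mul _ _ _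

lemma scal_sum {ι : Type*} (S : Finset ι) (f : ι → PowerSeries ℂ) :
    scal W (∑ i ∈ S, f i) = ∑ i ∈ S, scal W (f i) := map_sum _ _ _

/-- If conjugation by `e^{-σ}` acts on a family through the matrix of `e^{-σ}` on `V^j`, then so do
all complex powers of it: this holds for natural powers, and both sides are polynomial in the
exponent in each degree. -/
lemma conj_expSigma_of_neg_one {J : ℕ} (x : W) (T : Fin (J + 1) → PowerSeries W)
    (h1 : ∀ m, expSigma x (-1) * T m * expSigma x 1
      = ∑ k, scal W (sigmaMatrix J (-1) k m) * T k) (s : ℂ) (m : Fin (J + 1)) :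
    expSigma x (-s) * T m * expSigma x s = ∑ k, scal W (sigmaMatrix J (-s) k m) * T k := by
  have hnat : ∀ n : ℕ, ∀ m, expSigma x (-n) * T m * expSigma x n
      = ∑ k, scal W (sigmaMatrix J (-n) k m) * T k := by
    intro n
    induction n with
    | zero =>
      intro m
      simp [expSigma_zero, sigmaMatrix_zero, Matrix.one_apply, apply_ite (scal W), scal_one,
        scal_zero]
    | succ n ih =>
      intro m
      have e1 : expSigma x (-((n + 1 : ℕ) : ℂ)) * T m * expSigma x ((n + 1 : ℕ) : ℂ)
          = expSigma x (-n) * (expSigma x (-1) * T m * expSigma x 1) * expSigma x n := by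
        simp only [mul_assoc, expSigma_mul]
        rw [expSigma_mul_assoc]
        congr 2
        · push_cast; ring
        · congr 2; push_cast; ring
      rw [e1, h1, Finset.mul_sum, Finset.sum_mul]
      have e2 : ∀ k, expSigma x (-n) * (scal W (sigmaMatrix J (-1) k m) * T k) * expSigma x n
          = ∑ j, scal W (sigmaMatrix J (-n) j k * sigmaMatrix J (-1) k m) * T j := by
        intro k
        rw [← mul_assoc, ← (scal_commute _ _).eq, mul_assoc, mul_assoc, ← mul_assoc _ (T k), ih,
          Finset.mul_sum]
        refine Finset.sum_congr rfl fun j _ => ?_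
        rw [scal_mul, ← mul_assoc, (scal_commute _ _).eq]
      rw [Finset.sum_congr rfl fun k _ => e2 k, Finset.sum_comm]
      refine Finset.sum_congr rfl fun j _ => ?_
      rw [← Finset.sum_mul, ← scal_sum, ← Matrix.mul_apply, sigmaMatrix_mul]
      congr 4
      push_cast
      ring
  ext n
  rw [← sub_eq_zero]
  refine IsPolyFun.eq_zero (g := fun s => PowerSeries.coeff n (expSigma x (-s) * T m * expSigma x s)
    - PowerSeries.coeff n (∑ k, scal W (sigmaMatrix J (-s) k m) * T k)) ?_ ?_ s
  · have hneg : ∀ (i : ℕ) (s : ℂ),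
        (powPoly i).eval (-s) = ((powPoly i).comp (-Polynomial.X)).eval s := by
      intro i s
      simp
    refine IsPolyFun.sub ?_ ?_
    · simp only [PowerSeries.coeff_mul, coeff_expSigma_powPoly, Finset.sum_mul, smul_mul_assoc,
        mul_smul_comm, Finset.smul_sum, smul_smul, hneg, ← Polynomial.eval_mul]
      exact IsPolyFun.sum _ fun p _ => IsPolyFun.sum _ fun q _ => isPolyFun_smul _ _
    · simp only [map_sum, coeff_scal_mul, sigmaMatrix, Matrix.of_apply, PowerSeries.coeff_mk,
        coeff_expSigma_powPoly, Matrix.smul_apply, smul_assoc, hneg]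
      exact IsPolyFun.sum _ fun p _ => IsPolyFun.sum _ fun q _ => isPolyFun_smul _ _
  · intro i
    simp only [hnat, sub_self]

end Conjugation

/-! ### Conjugation of the components -/

section Ladder

variable {W : Type*} [Ring W] [Algebra ℂ W] {a abar : W}

lemma wt_injective (J : ℕ) : Function.Injective (wt J) := by
  intro i k hik
  simp only [wt] at hik
  exact Fin.ext (by omega)

/-- At the top of the ladder there is no component to raise to, and the coefficient vanishes. -/
lemma sum_matJp_smul {V : Type*} [AddCommGroup V] [Module ℂ V] (J : ℕ) (T : ℤ → V)
    (m : Fin (J + 1)) :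
    ∑ k, matJp J k m • T (wt J k) = (ladder J (wt J m) : ℂ) • T (wt J m + 2) := by
  by_cases hm : (m : ℕ) = 0
  · have h0 : ladder J (wt J m) = 0 := by simp [ladder, wt, hm]
    simp [matJp, h0]
  · have hk : (m : ℕ) - 1 < J + 1 := by omega
    have hw : wt J ⟨(m : ℕ) - 1, hk⟩ = wt J m + 2 := by
      simp only [wt]
      omega
    rw [Finset.sum_eq_single_of_mem (⟨(m : ℕ) - 1, hk⟩ : Fin (J + 1)) (Finset.mem_univ _)]
    · simp [matJp, hw]
    · intro k _ hne
      rw [matJp, Matrix.of_apply, if_neg, zero_smul]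
      exact fun h => hne (wt_injective J (h.trans hw.symm))

/-- `2h ad J₊(t) = t - e^{-σ} t e^{σ}`. -/
lemma two_X_adJp (x : W) (t : PowerSeries W) :
    (2 : ℂ) • (PowerSeries.X * adJp x t) = t - expSigma x (-1) * t * expSigma x 1 := by
  have h1 : (2 : ℂ) • (PowerSeries.X * (PowerSeries.C x * expSigma x 1)) = expSigma x 1 - 1 := by
    rw [← mul_assoc, ← smul_mul_assoc,
      show (2 : ℂ) • (PowerSeries.X * PowerSeries.C x) = 1 - expSigma x (-1) by
        rw [expSigma_neg_one]; abel, sub_mul, one_mul, expSigma_mul, neg_add_cancel, expSigma_zero]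
  have h2 : (2 : ℂ) • (PowerSeries.X * comm (PowerSeries.C x * expSigma x 1) t)
      = expSigma x 1 * t - t * expSigma x 1 := by
    have e : PowerSeries.X * (t * (PowerSeries.C x * expSigma x 1))
        = t * (PowerSeries.X * (PowerSeries.C x * expSigma x 1)) := by
      rw [← mul_assoc, ← (PowerSeries.commute_X t).eq, mul_assoc]
    rw [comm, mul_sub, e, smul_sub, ← mul_assoc PowerSeries.X, ← smul_mul_assoc, h1,
      ← mul_smul_comm, h1, sub_mul, mul_sub, one_mul, mul_one]
    abel
  rw [adJp, ← mul_assoc, ← (PowerSeries.commute_X _).eq, mul_assoc, ← mul_smul_comm, h2, mul_sub,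
    ← mul_assoc, expSigma_mul, neg_add_cancel, expSigma_zero, one_mul, mul_assoc]

lemma scal_smul_X_mul (c : ℂ) (t : PowerSeries W) :
    scal W (c • PowerSeries.X) * t = c • (PowerSeries.X * t) := by
  have : scal W (c • PowerSeries.X) = c • PowerSeries.X := by
    ext n
    rw [scal, PowerSeries.coeff_map, PowerSeries.coeff_smul, PowerSeries.coeff_smul,
      PowerSeries.coeff_X, PowerSeries.coeff_X, smul_eq_mul, map_mul, Algebra.smul_def]
    split_ifs <;> simp
  rw [this, smul_mul_assoc]

/-- Conjugation by `e^{sσ}` acts on the components `P̃_j^m` through the matrix of `e^{sσ}` on the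
spin-`j` representation. -/
lemma IsHSymplecton.conj_expSigma {N : ℕ → ℂ} {P : ℕ → ℤ → PowerSeries W}
    (hP : IsHSymplecton a abar N P) (J : ℕ) (s : ℂ) (m : Fin (J + 1)) :
    expSigma (bosJp a) (-s) * P J (wt J m) * expSigma (bosJp a) s
      = ∑ k, scal W (sigmaMatrix J (-s) k m) * P J (wt J k) := by
  refine conj_expSigma_of_neg_one (bosJp a) (fun m => P J (wt J m)) (fun m => ?_) s m
  have h := two_X_adJp (bosJp a) (P J (wt J m))
  rw [hP.raise, ← sum_matJp_smul, Finset.mul_sum, Finset.smul_sum] at h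
  have e : ∀ k, scal W (sigmaMatrix J (-1) k m) * P J (wt J k)
      = (if k = m then P J (wt J k) else 0)
        - (2 : ℂ) • (PowerSeries.X * matJp J k m • P J (wt J k)) := by
    intro k
    have : ∀ f g, scal W (f - g) = scal W f - scal W g := map_sub _
    rw [sigmaMatrix_neg_one, this, sub_mul, scal_smul_X_mul, Matrix.one_apply, mul_smul_comm,
      mul_smul]
    split_ifs
    · rw [scal_one, one_mul]
    · rw [scal_zero, zero_mul]
  rw [Finset.sum_congr rfl fun k _ => e k, Finset.sum_sub_distrib, h]
  simp

end Ladder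

/-! ### The matrix of the twist -/

section Twist

lemma kronecker_pow {m n : Type*} [Fintype m] [Fintype n] [DecidableEq m] [DecidableEq n]
    (A : Matrix m m ℂ) (B : Matrix n n ℂ) (k : ℕ) : (A ⊗ₖ B) ^ k = (A ^ k) ⊗ₖ (B ^ k) := by
  induction k with
  | zero => simp
  | succ k ih => rw [pow_succ, ih, ← Matrix.mul_kronecker_mul, pow_succ, pow_succ]

lemma coeff_sigma_pow {A : Type*} [Ring A] [Algebra ℂ A] (x : A) (n k : ℕ) :
    PowerSeries.coeff n (sigma x ^ k) = PowerSeries.coeff n (sigma (1 : ℂ) ^ k) • x ^ n := by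
  rw [← scaleHom_sigma, ← map_pow, coeff_scaleHom]

lemma coeff_expSigma_eq_sum {A : Type*} [Ring A] [Algebra ℂ A] (x : A) (t : ℂ) (n : ℕ) :
    PowerSeries.coeff n (expSigma x t) = (∑ k ∈ Finset.range (n + 1),
      (1 / (k ! : ℂ)) * (t ^ k * PowerSeries.coeff n (sigma (1 : ℂ) ^ k))) • x ^ n := by
  rw [expSigma, hexp, PowerSeries.coeff_mk, Finset.sum_smul]
  refine Finset.sum_congr rfl fun k _ => ?_
  rw [smul_pow, PowerSeries.coeff_smul, coeff_sigma_pow, smul_smul, smul_smul, mul_assoc]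

/-- Since `J₀` is diagonal, the twist is block diagonal, with blocks `e^{-mσ}`. -/
lemma twistMatrix_apply (J₁ J₂ : ℕ) (k m : Fin (J₁ + 1) × Fin (J₂ + 1)) :
    twistMatrix J₁ J₂ k m
      = if k.1 = m.1 then sigmaMatrix J₂ (-((wt J₁ m.1 : ℂ) / 2)) k.2 m.2 else 0 := by
  have hcomm : Commute
      (PowerSeries.C (matJ0 J₁ ⊗ₖ (1 : Matrix (Fin (J₂ + 1)) (Fin (J₂ + 1)) ℂ)))
      (sigma ((1 : Matrix (Fin (J₁ + 1)) (Fin (J₁ + 1)) ℂ) ⊗ₖ matJp J₂)) := by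
    ext1 n
    rw [PowerSeries.coeff_C_mul, PowerSeries.coeff_mul_C, sigma, PowerSeries.coeff_mk]
    split_ifs
    · simp
    · rw [mul_smul_comm, smul_mul_assoc, kronecker_pow, ← Matrix.mul_kronecker_mul,
        ← Matrix.mul_kronecker_mul, one_pow, one_mul, mul_one, one_mul, mul_one]
  ext n
  rw [twistMatrix, Matrix.of_apply, PowerSeries.coeff_mk, twistSeries, hexp, PowerSeries.coeff_mk,
    Matrix.sum_apply]
  have e : ∀ r ∈ Finset.range (n + 1), ((1 / (r ! : ℂ)) • PowerSeries.coeff n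
      ((-((1 / 2 : ℂ) • (PowerSeries.C
          (matJ0 J₁ ⊗ₖ (1 : Matrix (Fin (J₂ + 1)) (Fin (J₂ + 1)) ℂ))
        * sigma ((1 : Matrix (Fin (J₁ + 1)) (Fin (J₁ + 1)) ℂ) ⊗ₖ matJp J₂)))) ^ r)) k m
      = if k.1 = m.1 then (1 / (r ! : ℂ)) * ((-((wt J₁ m.1 : ℂ) / 2)) ^ r
          * PowerSeries.coeff n (sigma (1 : ℂ) ^ r)) * (matJp J₂ ^ n) k.2 m.2 else 0 := by
    intro r _
    rw [← neg_smul, smul_pow, hcomm.mul_pow, ← map_pow, PowerSeries.coeff_smul,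
      PowerSeries.coeff_C_mul, coeff_sigma_pow, mul_smul_comm, kronecker_pow, kronecker_pow,
      ← Matrix.mul_kronecker_mul, one_pow, one_pow, one_mul, mul_one, matJ0, Matrix.diagonal_pow,
      Matrix.smul_apply, Matrix.smul_apply, Matrix.smul_apply, Matrix.kronecker_apply,
      Matrix.diagonal_apply]
    split_ifs with h
    · rw [h, show -((wt J₁ m.1 : ℂ) / 2) = -(1 / 2) * (wt J₁ m.1 : ℂ) by ring, mul_pow]
      simp only [smul_eq_mul, Pi.pow_apply]
      ring
    · simp
  rw [Finset.sum_congr rfl e]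
  split_ifs with h
  · rw [sigmaMatrix, Matrix.of_apply, PowerSeries.coeff_mk, coeff_expSigma_eq_sum,
      Matrix.smul_apply, smul_eq_mul, Finset.sum_mul]
  · simp

lemma twistMatrix_inv_apply (J₁ J₂ : ℕ) (k m : Fin (J₁ + 1) × Fin (J₂ + 1)) :
    (twistMatrix J₁ J₂)⁻¹ k m
      = if k.1 = m.1 then sigmaMatrix J₂ ((wt J₁ m.1 : ℂ) / 2) k.2 m.2 else 0 := by
  have h : twistMatrix J₁ J₂ * (Matrix.of fun k m =>
      if k.1 = m.1 then sigmaMatrix J₂ ((wt J₁ m.1 : ℂ) / 2) k.2 m.2 else 0) = 1 := by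
    ext1 k m
    rw [Matrix.mul_apply, Fintype.sum_prod_type]
    simp only [twistMatrix_apply, Matrix.of_apply]
    rw [Finset.sum_eq_single_of_mem m.1 (Finset.mem_univ _)]
    · by_cases hk : k.1 = m.1
      · simp only [if_pos hk, if_true]
        rw [← Matrix.mul_apply, sigmaMatrix_mul, neg_add_cancel, sigmaMatrix_zero,
          Matrix.one_apply, Matrix.one_apply]
        simp [Prod.ext_iff, hk]
      · have : k ≠ m := fun h => hk (congrArg Prod.fst h)
        simp [hk, this]
    · intro i _ hi
      simp [hi]
  rw [Matrix.inv_eq_right_inv h, Matrix.of_apply]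

end Twist

/-! ### Noncommutative polynomials in `a_h`, `ā_h` -/

section Polynomials

variable {W : Type*} [Ring W] [Algebra ℂ W] {a abar : W}

lemma ah_mul_expSigma (a : W) (t : ℂ) :
    ah a * expSigma (bosJp a) t = expSigma (bosJp a) t * ah a := by
  rw [ah, mul_assoc, expSigma_mul, ← mul_assoc (expSigma _ t), ← commute_a_expSigma a t, mul_assoc,
    expSigma_mul, add_comm]

lemma expSigma_mul_ah (a : W) (t : ℂ) :
    expSigma (bosJp a) t * ah a * expSigma (bosJp a) (-t) = ah a := by
  rw [← ah_mul_expSigma, mul_assoc, expSigma_mul, add_neg_cancel, expSigma_zero, mul_one]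

/-- `e^{tσ} ā_h e^{-tσ} = ā_h + 2th a_h`. -/
lemma expSigma_mul_abarh (h : abar * a - a * abar = 1) (t : ℂ) :
    expSigma (bosJp a) t * abarh a abar * expSigma (bosJp a) (-t)
      = abarh a abar + (2 * t) • (PowerSeries.X * ah a) := by
  have e : expSigma (bosJp a) t * PowerSeries.C abar
      = PowerSeries.C abar * expSigma (bosJp a) t
        + (2 * t) • (PowerSeries.X * (PowerSeries.C a * expSigma (bosJp a) (t + 1))) := by
    rw [abar_mul_expSigma h]; abel
  rw [abarh, ah, ← mul_assoc, e, add_mul, add_mul, smul_mul_assoc, smul_mul_assoc]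
  simp only [mul_assoc, expSigma_mul]
  congr 4
  · ring
  · congr 2
    ring

/-- Conjugation by `e^{tσ}` shifts `ā_h` by `2th a_h` in every noncommutative polynomial. -/
lemma evalPoly_shift (h : abar * a - a * abar = 1) (t : ℂ) (p : FreeAlgebra ℂ (Fin 3)) :
    evalPoly (ah a) (abarh a abar + (2 * t) • (PowerSeries.X * ah a)) p
      = expSigma (bosJp a) t * evalPoly (ah a) (abarh a abar) p * expSigma (bosJp a) (-t) := by
  have hE : expSigma (bosJp a) (-t) * expSigma (bosJp a) t = 1 := by
    rw [expSigma_mul, neg_add_cancel, expSigma_zero]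
  have hE' : expSigma (bosJp a) t * expSigma (bosJp a) (-t) = 1 := by
    rw [expSigma_mul, add_neg_cancel, expSigma_zero]
  simp only [evalPoly]
  induction p using FreeAlgebra.induction with
  | grade0 r =>
    rw [AlgHom.commutes, AlgHom.commutes, ← Algebra.commutes, mul_assoc, hE', mul_one]
  | grade1 i =>
    rw [FreeAlgebra.lift_ι_apply, FreeAlgebra.lift_ι_apply]
    fin_cases i
    · change PowerSeries.X = _ * PowerSeries.X * _
      rw [(PowerSeries.commute_X _).eq, mul_assoc, hE', mul_one]
    · exact (expSigma_mul_ah a t).symm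
    · exact (expSigma_mul_abarh h t).symm
  | mul p q hp hq =>
    rw [map_mul, map_mul, hp, hq]
    simp only [mul_assoc]
    rw [← mul_assoc (expSigma _ (-t)) (expSigma _ t), hE, one_mul]
  | add p q hp hq =>
    rw [map_add, map_add, hp, hq, mul_add, add_mul]

/-- The algebra of noncommutative polynomials in `h`, `a_h`, `ā_h`. -/
def polySubalgebra (a abar : W) : Subalgebra ℂ (PowerSeries W) :=
  (FreeAlgebra.lift ℂ ![PowerSeries.X, ah a, abarh a abar]).range

lemma X_mem_polySubalgebra : PowerSeries.X ∈ polySubalgebra a abar :=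
  ⟨FreeAlgebra.ι ℂ 0, by
    rw [AlgHom.toRingHom_eq_coe, RingHom.coe_coe, FreeAlgebra.lift_ι_apply]; rfl⟩

lemma ah_mem_polySubalgebra : ah a ∈ polySubalgebra a abar :=
  ⟨FreeAlgebra.ι ℂ 1, by
    rw [AlgHom.toRingHom_eq_coe, RingHom.coe_coe, FreeAlgebra.lift_ι_apply]; rfl⟩

lemma abarh_mem_polySubalgebra : abarh a abar ∈ polySubalgebra a abar :=
  ⟨FreeAlgebra.ι ℂ 2, by
    rw [AlgHom.toRingHom_eq_coe, RingHom.coe_coe, FreeAlgebra.lift_ι_apply]; rfl⟩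

lemma conj_mem_polySubalgebra (h : abar * a - a * abar = 1) (t : ℂ) {y : PowerSeries W}
    (hy : y ∈ polySubalgebra a abar) :
    expSigma (bosJp a) t * y * expSigma (bosJp a) (-t) ∈ polySubalgebra a abar := by
  obtain ⟨p, rfl⟩ := hy
  have := evalPoly_shift h t p
  simp only [evalPoly] at this
  rw [AlgHom.toRingHom_eq_coe, RingHom.coe_coe, ← this]
  clear this
  induction p using FreeAlgebra.induction with
  | grade0 r => rw [AlgHom.commutes]; exact Subalgebra.algebraMap_mem _ _
  | grade1 i =>
    rw [FreeAlgebra.lift_ι_apply]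
    fin_cases i
    · exact X_mem_polySubalgebra
    · exact ah_mem_polySubalgebra
    · exact add_mem abarh_mem_polySubalgebra
        (Subalgebra.smul_mem _ (mul_mem X_mem_polySubalgebra ah_mem_polySubalgebra) _)
  | mul p q hp hq => rw [map_mul]; exact mul_mem hp hq
  | add p q hp hq => rw [map_add]; exact add_mem hp hq

/-- `a^u ā^v e^{(u-v)σ/2}` is a polynomial in `h`, `a_h`, `ā_h`: multiplying `t` by `ā` on the left
and by `e^{-σ/2}` on the right gives `ā_h (e^{σ/2} t e^{-σ/2})`. -/
lemma weylMono_mem_polySubalgebra (h : abar * a - a * abar = 1) (u v : ℕ) :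
    PowerSeries.C (weylMono a abar u v) * expSigma (bosJp a) (((u : ℂ) - v) / 2)
      ∈ polySubalgebra a abar := by
  induction v generalizing u with
  | zero =>
    rw [weylMono, Nat.cast_zero, sub_zero, ← ah_pow]
    exact pow_mem ah_mem_polySubalgebra _
  | succ v ih =>
    rw [weylMono, map_sub, map_mul, C_smul, sub_mul, smul_mul_assoc]
    refine sub_mem ?_ ?_
    · have e : PowerSeries.C abar * PowerSeries.C (weylMono a abar u v)
          * expSigma (bosJp a) (((u : ℂ) - ((v + 1 : ℕ) : ℂ)) / 2)
          = abarh a abar * (expSigma (bosJp a) (1 / 2)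
            * (PowerSeries.C (weylMono a abar u v) * expSigma (bosJp a) (((u : ℂ) - v) / 2))
            * expSigma (bosJp a) (-(1 / 2))) := by
        rw [abarh]
        simp only [mul_assoc, expSigma_mul]
        rw [expSigma_mul_assoc, neg_add_cancel, expSigma_zero, one_mul]
        congr 4
        push_cast
        ring
      rw [e]
      exact mul_mem abarh_mem_polySubalgebra (conj_mem_polySubalgebra h _ (ih u))
    · cases u with
      | zero => simp
      | succ u =>
        have := Subalgebra.smul_mem _ (ih u) (((u + 1 : ℕ) : ℂ) / 2)
        rw [show (((u + 1 : ℕ) : ℂ) - ((v + 1 : ℕ) : ℂ)) / 2 = ((u : ℂ) - v) / 2 by push_cast; ring,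
          Nat.add_sub_cancel]
        exact this

end Polynomials

/-! ### The Clebsch–Gordan coefficients in the Moyal product -/

lemma halfFact_eq {z : ℤ} (n : ℕ) (h : z = 2 * n) : halfFact z = (n ! : ℝ) := by
  rw [halfFact, h, Int.mul_ediv_cancel_left _ two_ne_zero, Int.toNat_natCast]

/-- Racah's sum for the Clebsch–Gordan coefficient is the sum over the terms of order `r` of the
Moyal product; the reduced matrix element cancels the triangle coefficient in Racah's formula. -/
lemma redElt_mul_clebschGordan {p q c d r K u v : ℕ} (hK : K + 2 * r = p + q + (c + d))
    (hr : r ≤ p + q) (hr' : r ≤ c + d) (hu : u + r = p + c) (hv : v + r = q + d) :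
    redElt K (p + q) (c + d)
        * clebschGordan (c + d) (p + q) K ((c : ℤ) - d) ((p : ℤ) - q) ((c : ℤ) - d + (p - q))
      = (1 / 2) ^ r * Real.sqrt ((p ! : ℝ) * q ! * (c ! * d !) * (u ! * v !))
        * ∑ k ∈ Finset.range (r + 1), (-1 : ℝ) ^ k * invFact k * invFact ((r : ℤ) - k)
            * invFact ((p : ℤ) - k) * invFact ((q : ℤ) - (r - k)) * invFact ((c : ℤ) - (r - k))
            * invFact ((d : ℤ) - k) := by
  have hcond : K ∈ coupledSpins (c + d) (p + q) ∧ IsWeight (c + d) ((c : ℤ) - d)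
      ∧ IsWeight (p + q) ((p : ℤ) - q) ∧ IsWeight K ((c : ℤ) - d + (p - q))
      ∧ (c : ℤ) - d + (p - q) = (c : ℤ) - d + (p - q) := by
    refine ⟨?_, ⟨?_, ?_⟩, ⟨?_, ?_⟩, ⟨?_, ?_⟩, rfl⟩
    · rw [coupledSpins, Finset.mem_filter, Finset.mem_Icc, Nat.dist]
      omega
    · rw [abs_le]; omega
    · push_cast; omega
    · rw [abs_le]; omega
    · push_cast; omega
    · rw [abs_le]; omega
    · omega
  rw [clebschGordan, if_pos hcond, redElt, nabla]
  -- `x = j - j' + k` and `y = j' - j + k`, the arguments of the factorials in the triangle function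
  obtain ⟨x, hx⟩ : ∃ x, x + r = p + q := ⟨p + q - r, by omega⟩
  obtain ⟨y, hy⟩ : ∃ y, y + r = c + d := ⟨c + d - r, by omega⟩
  have hrange : (c + d + (p + q) - K) / 2 + 1 = r + 1 := by omega
  rw [hrange,
    halfFact_eq (z := (K : ℤ) + ((p + q : ℕ) : ℤ) + ((c + d : ℕ) : ℤ) + 2) (x + y + r + 1)
      (by push_cast; omega),
    halfFact_eq (z := ((c + d : ℕ) : ℤ) + ((p + q : ℕ) : ℤ) + K + 2) (x + y + r + 1)
      (by push_cast; omega),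
    halfFact_eq (z := (K : ℤ) + ((p + q : ℕ) : ℤ) - ((c + d : ℕ) : ℤ)) x (by push_cast; omega),
    halfFact_eq (z := (K : ℤ) - ((p + q : ℕ) : ℤ) + ((c + d : ℕ) : ℤ)) y (by push_cast; omega),
    halfFact_eq (z := -(K : ℤ) + ((p + q : ℕ) : ℤ) + ((c + d : ℕ) : ℤ)) r (by push_cast; omega),
    halfFact_eq (z := (K : ℤ) + ((c + d : ℕ) : ℤ) - ((p + q : ℕ) : ℤ)) y (by push_cast; omega),
    halfFact_eq (z := (K : ℤ) - ((c + d : ℕ) : ℤ) + ((p + q : ℕ) : ℤ)) x (by push_cast; omega),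
    halfFact_eq (z := ((c + d : ℕ) : ℤ) + ((p + q : ℕ) : ℤ) - K) r (by push_cast; omega),
    halfFact_eq (z := (K : ℤ) + ((c : ℤ) - d + (p - q))) u (by omega),
    halfFact_eq (z := (K : ℤ) - ((c : ℤ) - d + (p - q))) v (by omega),
    halfFact_eq (z := ((c + d : ℕ) : ℤ) - ((c : ℤ) - d)) d (by push_cast; omega),
    halfFact_eq (z := ((c + d : ℕ) : ℤ) + ((c : ℤ) - d)) c (by push_cast; omega),
    halfFact_eq (z := ((p + q : ℕ) : ℤ) - ((p : ℤ) - q)) q (by push_cast; omega),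
    halfFact_eq (z := ((p + q : ℕ) : ℤ) + ((p : ℤ) - q)) p (by push_cast; omega)]
  have hpow : (2 : ℝ) ^ (((K : ℤ) - ((p + q : ℕ) : ℤ) - ((c + d : ℕ) : ℤ)) / 2) = (1 / 2) ^ r := by
    have : ((K : ℤ) - ((p + q : ℕ) : ℤ) - ((c + d : ℕ) : ℤ)) / 2 = -(r : ℤ) := by
      push_cast; omega
    rw [this, zpow_neg, zpow_natCast, one_div, inv_pow]
  have hsum : ∀ k ∈ Finset.range (r + 1),
      (-1 : ℝ) ^ k * invFact k * invFact ((((c + d : ℕ) : ℤ) + ((p + q : ℕ) : ℤ) - K) / 2 - k)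
          * invFact ((((c + d : ℕ) : ℤ) - ((c : ℤ) - d)) / 2 - k)
          * invFact ((((p + q : ℕ) : ℤ) + ((p : ℤ) - q)) / 2 - k)
          * invFact (((K : ℤ) - ((p + q : ℕ) : ℤ) + ((c : ℤ) - d)) / 2 + k)
          * invFact (((K : ℤ) - ((c + d : ℕ) : ℤ) - ((p : ℤ) - q)) / 2 + k)
        = (-1 : ℝ) ^ k * invFact k * invFact ((r : ℤ) - k)
            * invFact ((p : ℤ) - k) * invFact ((q : ℤ) - (r - k)) * invFact ((c : ℤ) - (r - k))
            * invFact ((d : ℤ) - k) := by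
    intro k _
    rw [show (((c + d : ℕ) : ℤ) + ((p + q : ℕ) : ℤ) - K) / 2 - k = (r : ℤ) - k by
        push_cast; omega,
      show (((c + d : ℕ) : ℤ) - ((c : ℤ) - d)) / 2 - k = (d : ℤ) - k by push_cast; omega,
      show (((p + q : ℕ) : ℤ) + ((p : ℤ) - q)) / 2 - k = (p : ℤ) - k by push_cast; omega,
      show ((K : ℤ) - ((p + q : ℕ) : ℤ) + ((c : ℤ) - d)) / 2 + k = (c : ℤ) - (r - k) by
        push_cast; omega,
      show ((K : ℤ) - ((c + d : ℕ) : ℤ) - ((p : ℤ) - q)) / 2 + k = (q : ℤ) - (r - k) by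
        push_cast; omega]
    ring
  rw [hpow, Finset.sum_congr rfl hsum]
  have hK1 : (0 : ℝ) < (K : ℝ) + 1 := by positivity
  have htri : (Real.sqrt ((K : ℝ) + 1))⁻¹
        * Real.sqrt (((x + y + r + 1)! : ℝ) / ((x ! : ℝ) * y ! * r !))
        * Real.sqrt (((K : ℝ) + 1) * y ! * x ! * r ! / ((x + y + r + 1)! : ℝ)) = 1 := by
    rw [← Real.sqrt_inv, ← Real.sqrt_mul (by positivity), ← Real.sqrt_mul (by positivity),
      Real.sqrt_eq_one]
    field_simp
  have hroot : (u ! : ℝ) * v ! * d ! * c ! * q ! * p !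
      = (p ! : ℝ) * q ! * (c ! * d !) * (u ! * v !) := by ring
  rw [hroot]
  linear_combination (1 / 2) ^ r * Real.sqrt ((p ! : ℝ) * q ! * (c ! * d !) * (u ! * v !))
        * (∑ k ∈ Finset.range (r + 1), (-1 : ℝ) ^ k * invFact k * invFact ((r : ℤ) - k)
            * invFact ((p : ℤ) - k) * invFact ((q : ℤ) - (r - k)) * invFact ((c : ℤ) - (r - k))
            * invFact ((d : ℤ) - k)) * htri

lemma sum_range_range_eq_sum_antidiagonal {V : Type*} [AddCommMonoid V] {t : ℕ → ℕ → V} {M R : ℕ}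
    (hRM : R < M) (h0 : ∀ i k, R < i + k → t i k = 0) :
    ∑ i ∈ Finset.range M, ∑ k ∈ Finset.range M, t i k
      = ∑ r ∈ Finset.range (R + 1), ∑ k ∈ Finset.range (r + 1), t (r - k) k := by
  rw [Finset.sum_range_diag_flip (R + 1) fun k i => t i k, Finset.sum_comm]
  symm
  refine Finset.sum_subset_zero_on_sdiff (fun k hk => ?_) (fun k hk => ?_) (fun k hk => ?_)
  · rw [Finset.mem_range] at hk ⊢; omega
  · rw [Finset.mem_sdiff, Finset.mem_range, Finset.mem_range] at hk
    exact Finset.sum_eq_zero fun i _ => h0 i k (by omega)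
  · refine Finset.sum_subset (fun i hi => ?_) (fun i _ hi => ?_)
    · rw [Finset.mem_range] at hi ⊢; omega
    · rw [Finset.mem_range] at hi hk
      exact h0 i k (by omega)

lemma sum_coupledSpins {V : Type*} [AddCommMonoid V] (J J' : ℕ) (F : ℕ → V) :
    ∑ K ∈ coupledSpins J J', F K = ∑ r ∈ Finset.range (min J J' + 1), F (J + J' - 2 * r) := by
  refine Finset.sum_nbij' (fun K => (J + J' - K) / 2) (fun r => J + J' - 2 * r) ?_ ?_ ?_ ?_ ?_
  all_goals
    simp only [coupledSpins, Finset.mem_filter, Finset.mem_Icc, Finset.mem_range, Nat.dist]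
    intro K hK
  · omega
  · omega
  · omega
  · omega
  · congr 1
    omega

lemma clebschGordan_of_not_isWeight {J₁ J₂ J : ℕ} {M₁ M₂ M : ℤ} (h : ¬ IsWeight J M) :
    clebschGordan J₁ J₂ J M₁ M₂ M = 0 := by
  rw [clebschGordan, if_neg]
  tauto

section Product

variable {W : Type*} [Ring W] [Algebra ℂ W] {a abar : W}

/-- The terms of order `r` of the Moyal product of two components of the symplecton assemble to the
component of spin `j + j' - r`. -/
lemma IsHSymplecton.clebschGordan_smul (h : abar * a - a * abar = 1) {N : ℕ → ℂ}
    (hN : ∀ J, N J ≠ 0) {P : ℕ → ℤ → PowerSeries W} (hP : IsHSymplecton a abar N P)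
    {p q c d r : ℕ} (hr : r ≤ p + q) (hr' : r ≤ c + d) :
    ((N (p + q) * N (c + d) / N (p + q + (c + d) - 2 * r))
        * (redElt (p + q + (c + d) - 2 * r) (p + q) (c + d) : ℂ)
        * (clebschGordan (c + d) (p + q) (p + q + (c + d) - 2 * r) ((c : ℤ) - d) ((p : ℤ) - q)
            ((c : ℤ) - d + (p - q)) : ℂ))
        • P (p + q + (c + d) - 2 * r) ((p : ℤ) - q + (c - d))
      = PowerSeries.C ((normCoeff (N (p + q)) p q * normCoeff (N (c + d)) c d
            * ((p ! : ℂ) * q ! * c ! * d !))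
          • ∑ k ∈ Finset.range (r + 1), moyalTerm a abar p q c d 0 0 (r - k) k)
        * expSigma (bosJp a) (((p : ℂ) - q + (c - d)) / 2) := by
  obtain ⟨K, hK⟩ : ∃ K, K = p + q + (c + d) - 2 * r := ⟨_, rfl⟩
  rw [← hK]
  by_cases hw : r ≤ p + c ∧ r ≤ q + d
  · obtain ⟨u, hu⟩ : ∃ u, u + r = p + c := ⟨p + c - r, by omega⟩
    obtain ⟨v, hv⟩ : ∃ v, v + r = q + d := ⟨q + d - r, by omega⟩
    have hterm : ∀ k ∈ Finset.range (r + 1), moyalTerm a abar p q c d 0 0 (r - k) k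
        = ((((1 / 2) ^ r * ((-1 : ℝ) ^ k * invFact k * invFact ((r : ℤ) - k)
            * invFact ((p : ℤ) - k) * invFact ((q : ℤ) - (r - k)) * invFact ((c : ℤ) - (r - k))
            * invFact ((d : ℤ) - k))) : ℝ) : ℂ) • weylMono a abar u v := by
      intro k hk
      have hk' : k ≤ r := Nat.lt_succ_iff.1 (Finset.mem_range.1 hk)
      rw [moyalTerm, moyalCoeff, Nat.cast_sub hk',
        show (p : ℤ) + c - (r - k) - k + 0 = u by omega,
        show (q : ℤ) + d - (r - k) - k + 0 = v by omega, weylZ_natCast]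
      congr 1
      have e : (1 / 2 : ℂ) ^ (r - k) * (-1 / 2) ^ k = (1 / 2) ^ r * (-1) ^ k := by
        rw [show (-1 / 2 : ℂ) = 1 / 2 * -1 by ring, mul_pow, ← mul_assoc, ← pow_add,
          Nat.sub_add_cancel hk']
      rw [e]
      push_cast
      ring
    rw [Finset.sum_congr rfl hterm, ← Finset.sum_smul, ← Complex.ofReal_sum, ← Finset.mul_sum]
    have hP' := hP.eq_weylMono h u v
    rw [show u + v = K by omega, show (u : ℤ) - v = (p : ℤ) - q + (c - d) by omega,
      show ((u : ℂ) - v) / 2 = ((p : ℂ) - q + (c - d)) / 2 by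
        have hu' : (u : ℂ) + r = p + c := by exact_mod_cast hu
        have hv' : (v : ℂ) + r = q + d := by exact_mod_cast hv
        linear_combination (hu' - hv') / 2] at hP'
    rw [hP', ← smul_mul_assoc, ← C_smul, smul_smul, smul_smul]
    congr 3
    rw [mul_assoc (_ / _), ← Complex.ofReal_mul,
      redElt_mul_clebschGordan (by omega) hr hr' hu hv]
    set S := ∑ k ∈ Finset.range (r + 1), (-1 : ℝ) ^ k * invFact k * invFact ((r : ℤ) - k)
            * invFact ((p : ℤ) - k) * invFact ((q : ℤ) - (r - k)) * invFact ((c : ℤ) - (r - k))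
            * invFact ((d : ℤ) - k)
    have hs : ∀ x y : ℕ, (Real.sqrt ((x ! : ℝ) * y !) : ℂ) ≠ 0 := fun x y => by
      exact_mod_cast (Real.sqrt_pos.2 (by positivity)).ne'
    have hsq : ∀ x y : ℕ, (Real.sqrt ((x ! : ℝ) * y !) : ℂ) ^ 2 = (x ! : ℂ) * y ! := fun x y => by
      rw [← Complex.ofReal_pow, Real.sq_sqrt (by positivity)]
      push_cast
      rfl
    rw [Real.sqrt_mul (by positivity), Real.sqrt_mul (by positivity), normCoeff, normCoeff,
      normCoeff, show (p ! : ℂ) * q ! * c ! * d ! = (p ! * q !) * (c ! * d !) by ring, ← hsq p q,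
      ← hsq c d]
    have := hs p q
    have := hs c d
    have := hs u v
    have := hN K
    push_cast
    field_simp
  · -- one exponent would be negative: the Clebsch–Gordan coefficient and the Moyal terms vanish
    have hnot : ¬ IsWeight K ((c : ℤ) - d + (p - q)) := by
      rintro ⟨hab, -⟩
      rw [abs_le] at hab
      omega
    have hterm : ∀ k ∈ Finset.range (r + 1), moyalTerm a abar p q c d 0 0 (r - k) k = 0 := by
      intro k hk
      have hk' : k ≤ r := Nat.lt_succ_iff.1 (Finset.mem_range.1 hk)
      rw [moyalTerm, moyalCoeff_eq_zero (by omega), zero_smul]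
    rw [clebschGordan_of_not_isWeight hnot, Finset.sum_eq_zero hterm, smul_zero, map_zero, zero_mul,
      Complex.ofReal_zero, mul_zero, zero_smul]

/-- The product law of the undeformed symplecton, multiplied by `e^{(m+m')σ}`. -/
lemma IsHSymplecton.sum_clebschGordan_smul (h : abar * a - a * abar = 1) {N : ℕ → ℂ}
    (hN : ∀ J, N J ≠ 0) {P : ℕ → ℤ → PowerSeries W} (hP : IsHSymplecton a abar N P)
    (p q c d : ℕ) :
    ∑ K ∈ coupledSpins (p + q) (c + d),
        ((N (p + q) * N (c + d) / N K) * (redElt K (p + q) (c + d) : ℂ)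
          * (clebschGordan (c + d) (p + q) K ((c : ℤ) - d) ((p : ℤ) - q)
              ((c : ℤ) - d + (p - q)) : ℂ)) • P K ((p : ℤ) - q + (c - d))
      = PowerSeries.C ((normCoeff (N (p + q)) p q • weylMono a abar p q)
          * (normCoeff (N (c + d)) c d • weylMono a abar c d))
        * expSigma (bosJp a) (((p : ℂ) - q + (c - d)) / 2) := by
  rw [sum_coupledSpins]
  have hr : ∀ r ∈ Finset.range (min (p + q) (c + d) + 1), r ≤ p + q ∧ r ≤ c + d := by
    intro r hr
    rw [Finset.mem_range] at hr
    omega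
  rw [Finset.sum_congr rfl fun r hr' => hP.clebschGordan_smul h hN (hr r hr').1 (hr r hr').2,
    ← Finset.sum_mul, ← map_sum, ← Finset.smul_sum]
  have hM : p < p + q + (c + d) + 1 := by omega
  have hM' : q < p + q + (c + d) + 1 := by omega
  have e := weylMono_mul_weylMono h c d hM hM'
  rw [moyalSum, sum_range_range_eq_sum_antidiagonal (R := min (p + q) (c + d)) (by omega)] at e
  · have hne : ((p ! : ℂ) * q ! * c ! * d !) ≠ 0 := by
      exact_mod_cast (by positivity : p ! * q ! * c ! * d ! ≠ 0)
    rw [← e, smul_smul, smul_mul_smul_comm, mul_assoc, mul_one_div_cancel hne, mul_one]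
  · intro i k hik
    rw [moyalTerm, moyalCoeff_eq_zero (by omega), zero_smul]

end Product

/-! ### Products of components and shifts of the argument -/

section Product

variable {W : Type*} [Ring W] [Algebra ℂ W] {a abar : W}

/-- The matrix elements of the twist cancel the factors `e^{mσ}` between the two components, up to
one overall factor `e^{(m+m')σ}`. -/
lemma IsHSymplecton.sum_mul_twistMatrix {N : ℕ → ℂ} {P : ℕ → ℤ → PowerSeries W}
    (hP : IsHSymplecton a abar N P) (J J' : ℕ) (l : Fin (J + 1)) (l' : Fin (J' + 1)) :
    ∑ m : Fin (J + 1), ∑ m' : Fin (J' + 1),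
        P J (wt J m) * P J' (wt J' m') * scal W (twistMatrix J J' (m, m') (l, l'))
      = P J (wt J l) * (expSigma (bosJp a) (-((wt J l : ℂ) / 2)) * P J' (wt J' l')
          * expSigma (bosJp a) ((wt J l : ℂ) / 2)) := by
  rw [Finset.sum_eq_single_of_mem l (Finset.mem_univ _), hP.conj_expSigma, Finset.mul_sum]
  · refine Finset.sum_congr rfl fun m' _ => ?_
    rw [twistMatrix_apply, if_pos rfl, mul_assoc, (scal_commute _ _).eq]
  · intro m _ hm
    refine Finset.sum_eq_zero fun m' _ => ?_
    rw [twistMatrix_apply, if_neg hm, scal_zero, mul_zero]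

/-- Weights decrease along the index and `J₊` raises them, so that `e^{tσ}` is upper triangular. -/
lemma sigmaMatrix_eq_zero_of_lt (J : ℕ) (t : ℂ) {k m : Fin (J + 1)} (h : m < k) :
    sigmaMatrix J t k m = 0 := by
  have hpow : ∀ (n : ℕ) (k m : Fin (J + 1)), m < k → (matJp J ^ n) k m = 0 := by
    intro n
    induction n with
    | zero => intro k m hkm; rw [pow_zero, Matrix.one_apply_ne hkm.ne']
    | succ n ih =>
      intro k m hkm
      rw [pow_succ, Matrix.mul_apply]
      refine Finset.sum_eq_zero fun j _ => ?_
      by_cases hj : j < k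
      · rw [ih k j hj, zero_mul]
      · rw [matJp, Matrix.of_apply, if_neg, mul_zero]
        simp only [wt]
        omega
  ext n
  rw [sigmaMatrix, Matrix.of_apply, PowerSeries.coeff_mk, coeff_expSigma, Matrix.smul_apply,
    hpow n k m h, smul_zero, map_zero]

/-- Conjugation by `e^{mσ}` as a sum over the components above `m'`, in increasing order of the
weight. -/
lemma IsHSymplecton.conj_eq_sum_twistMatrix_inv {N : ℕ → ℂ} {P : ℕ → ℤ → PowerSeries W}
    (hP : IsHSymplecton a abar N P) (J J' : ℕ) (m : Fin (J + 1)) (m' : Fin (J' + 1)) :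
    expSigma (bosJp a) ((wt J m : ℂ) / 2) * P J' (wt J' m')
        * expSigma (bosJp a) (-((wt J m : ℂ) / 2))
      = ∑ l : Fin ((m' : ℕ) + 1),
          scal W ((twistMatrix J J')⁻¹
              (m, ⟨(m' : ℕ) - (l : ℕ), lt_of_le_of_lt (Nat.sub_le _ _) m'.isLt⟩) (m, m'))
            * P J' (wt J' m' + 2 * ((l : ℕ) : ℤ)) := by
  have h := hP.conj_expSigma J' (-((wt J m : ℂ) / 2)) m'
  rw [neg_neg] at h
  rw [h]
  symm
  have hwt : ∀ l : Fin ((m' : ℕ) + 1), wt J' m' + 2 * ((l : ℕ) : ℤ)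
      = wt J' ⟨(m' : ℕ) - (l : ℕ), lt_of_le_of_lt (Nat.sub_le _ _) m'.isLt⟩ := by
    intro l
    simp only [wt]
    omega
  simp only [twistMatrix_inv_apply, if_true, hwt]
  have hinj : Function.Injective fun l : Fin ((m' : ℕ) + 1) =>
      (⟨(m' : ℕ) - (l : ℕ), lt_of_le_of_lt (Nat.sub_le _ _) m'.isLt⟩ : Fin (J' + 1)) := by
    intro l₁ l₂ hl
    have := Fin.mk.inj_iff.1 hl
    exact Fin.ext (by omega)
  refine Fintype.sum_of_injective _ hinj _
    (fun k => scal W (sigmaMatrix J' ((wt J m : ℂ) / 2) k m') * P J' (wt J' k))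
    (fun k hk => ?_) fun l => rfl
  rw [sigmaMatrix_eq_zero_of_lt, scal_zero, zero_mul]
  by_contra hle
  refine hk ⟨⟨(m' : ℕ) - k, by omega⟩, Fin.ext ?_⟩
  simp only
  omega

end Product

end HSymplecton

end

theorem proposition3 {W : Type*} [Ring W] [Algebra ℂ W] (a abar : W)
    (hboson : abar * a - a * abar = 1)
    (N : ℕ → ℂ) (hN : ∀ J, N J ≠ 0)
    (P : ℕ → ℤ → PowerSeries W) (hP : HSymplecton.IsHSymplecton a abar N P)
    (J J' : ℕ) :
    (∀ (l : Fin (J + 1)) (l' : Fin (J' + 1)),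
      ∑ m : Fin (J + 1), ∑ m' : Fin (J' + 1),
          P J (HSymplecton.wt J m) * P J' (HSymplecton.wt J' m')
            * HSymplecton.scal W (HSymplecton.twistMatrix J J' (m, m') (l, l'))
        = ∑ K ∈ HSymplecton.coupledSpins J J',
            ((N J * N J' / N K) * (HSymplecton.redElt K J J' : ℂ)
              * (HSymplecton.clebschGordan J' J K (HSymplecton.wt J' l') (HSymplecton.wt J l)
                  (HSymplecton.wt J' l' + HSymplecton.wt J l) : ℂ))
              • P K (HSymplecton.wt J l + HSymplecton.wt J' l'))
    ∧ (∀ (m : Fin (J + 1)) (m' : Fin (J' + 1)),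
      (∃ p : FreeAlgebra ℂ (Fin 3),
        HSymplecton.evalPoly (HSymplecton.ah a) (HSymplecton.abarh a abar) p
          = P J' (HSymplecton.wt J' m')) ∧
      ∀ p : FreeAlgebra ℂ (Fin 3),
        HSymplecton.evalPoly (HSymplecton.ah a) (HSymplecton.abarh a abar) p
          = P J' (HSymplecton.wt J' m') →
        HSymplecton.evalPoly (HSymplecton.ah a)
            (HSymplecton.abarh a abar
              + (HSymplecton.wt J m : ℂ) • (PowerSeries.X * HSymplecton.ah a)) p
          = ∑ l : Fin ((m' : ℕ) + 1),
              HSymplecton.scal W ((HSymplecton.twistMatrix J J')⁻¹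
                  (m, ⟨(m' : ℕ) - (l : ℕ), lt_of_le_of_lt (Nat.sub_le _ _) m'.isLt⟩) (m, m'))
                * P J' (HSymplecton.wt J' m' + 2 * ((l : ℕ) : ℤ))) := by
  open HSymplecton in
  refine ⟨fun l l' => ?_, fun m m' => ⟨?_, fun p hp => ?_⟩⟩
  · obtain ⟨i, hi⟩ := l
    obtain ⟨i', hi'⟩ := l'
    obtain ⟨u, rfl⟩ : ∃ u, J = u + i := ⟨J - i, by omega⟩
    obtain ⟨u', rfl⟩ : ∃ u', J' = u' + i' := ⟨J' - i', by omega⟩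
    have hw : wt (u + i) ⟨i, hi⟩ = (u : ℤ) - i := by simp only [wt]; push_cast; ring
    have hw' : wt (u' + i') ⟨i', hi'⟩ = (u' : ℤ) - i' := by simp only [wt]; push_cast; ring
    rw [hP.sum_mul_twistMatrix, hw, hw', hP.sum_clebschGordan_smul hboson hN,
      hP.eq_weylMono hboson, hP.eq_weylMono hboson, map_mul]
    simp only [mul_assoc, expSigma_mul]
    rw [expSigma_mul_assoc]
    push_cast
    rw [add_neg_cancel, expSigma_zero, one_mul]
    congr 4
    ring
  · have hmem := Subalgebra.smul_mem _ (weylMono_mem_polySubalgebra hboson (J' - m') m')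
      (normCoeff (N J') (J' - m') m')
    obtain ⟨p, hp⟩ := hmem
    refine ⟨p, hp.trans ?_⟩
    have hm' : (m' : ℕ) ≤ J' := Nat.lt_succ_iff.1 m'.2
    rw [hP.eq_weylMono_wt hboson, C_smul, smul_mul_assoc, wt]
    congr 4
    rw [Nat.cast_sub hm']
    push_cast
    ring
  · have e : (wt J m : ℂ) • (PowerSeries.X * ah a)
        = (2 * ((wt J m : ℂ) / 2)) • (PowerSeries.X * ah a) := by
      congr 1
      ring
    rw [e, evalPoly_shift hboson, hp, hP.conj_eq_sum_twistMatrix_inv]
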